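/- Four point vortices with strengths $\Gamma_1=\Gamma_2=1$, $\Gamma_3=\Gamma_4=m$ at distinct positions $x_1,\dots,x_4\in\mathbb{R}^2$, where $m\in(-1,1]$, form a relative equilibrium with angular velocity $\lambda\neq 0$ if there is a point $c\in\mathbb{R}^2$ with $$-\lambda(x_i-c)=\sum_{j\ne i}\frac{\Gamma_j}{\|x_i-x_j\|^2}(x_j-x_i),\qquad i=1,\dots,4 .$$ Fix the scale by $\lambda'=-\lambda/\Gamma=-1$, where $\Gamma=\sum_i\Gamma_i=2+2m$. Put $s_{ij}=\|x_i-x_j\|^2$, and let $A\subset\mathbb{R}^7$ be the set of all points $(s_{12},s_{13},s_{14},s_{23},s_{24},s_{34},m)$, $-1<m\le 1$, that come from such relative equilibria which are strictly planar (not collinear) and asymmetric (no reflection in a line maps $\{x_1,\dots,x_4\}$ onto itself). In $\mathbb{R}[s_{12},s_{13},s_{14},s_{23},s_{24},s_{34},m]$ let $$\begin{aligned} f_1&=s_{13}+s_{14}+s_{23}+s_{24}-2s_{34}-1,\\ f_2&=s_{12}-s_{34}+1,\\ f_3&=s_{34}m+s_{34}-m-2,\\ f_4&=2s_{24}^2-s_{14}s_{34}-s_{23}s_{34}-4s_{24}s_{34}+2s_{34}^2+2s_{23},\\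 f_5&=2s_{23}s_{24}-2s_{23}-2s_{24}+s_{34},\\ f_6&=2s_{14}s_{24}-s_{34},\\ f_7&=2s_{23}^2+s_{14}s_{34}-3s_{23}s_{34}+2s_{24}-s_{34},\\ f_8&=2s_{14}s_{23}-s_{14}s_{34}-s_{23}s_{34}+s_{34},\\ f_9&=2s_{14}^2-3s_{14}s_{34}+s_{23}s_{34}-2s_{14}-2s_{23}-2s_{24}+3s_{34}+2, \end{aligned}$$ let $I=\langle f_1,\dots,f_9\rangle$ and let $V=\mathbf{V}(I)\subset\mathbb{R}^7$ be its set of real zeros. Theorem. The asymmetric relative equilibria form the one-dimensional real algebraic variety $V$, up to two symmetric limit points. Precisely: (a) $A=V\setminus\{P,Q\}$, where $P=(\tfrac12,\tfrac12,\tfrac12,\tfrac32,\tfrac32,\tfrac32,1)$ and $Q=(\tfrac12,\tfrac32,\tfrac32,\tfrac12,\tfrac12,\tfrac32,1)$ (these are the equilateral triangles with a vortex at the center, for $m=1$), and $V$ is the Zariski closure of $A$. (b) The ideal $\mathbf{I}(V)$ of all polynomials vanishing on $V$ is $I$, and $I$ is its own real radical, that is, $I$ is equal to the smallest ideal $J\supseteq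 I$ such that $a_1^2+\cdots+a_p^2\in J$ implies $a_1,\dots,a_p\in J$. (c) $\dim V=1$, that is, the affine Hilbert polynomial of $\mathbf{I}(V)$ (the polynomial that agrees with $s\mapsto\dim_{\mathbb{R}}\mathbb{R}[s_{12},\dots,m]_{\le s}/\mathbf{I}(V)_{\le s}$ for all large integers $s$) has degree $1$. -/

import Mathlib

noncomputable section

namespace FourVortex

/-! ### Relative equilibria of planar point vortices -/

/-- The Euclidean plane. -/
abbrev Plane : Type := EuclideanSpace ℝ (Fin 2)

/-- The positions `x` of `n` distinct point vortices with strengths `Γ` generate a relative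
equilibrium with angular velocity `ω ≠ 0` (a uniform rotation about some center `c`):
`-ω (x i - c) = ∑_{j ≠ i} Γ j / ‖x i - x j‖² • (x j - x i)` for every `i`. -/
def IsRelativeEquilibrium {n : ℕ} (Γ : Fin n → ℝ) (ω : ℝ) (x : Fin n → Plane) : Prop :=
  ω ≠ 0 ∧ Function.Injective x ∧
    ∃ c : Plane, ∀ i : Fin n,
      (-ω) • (x i - c) =
        ∑ j ∈ Finset.univ.erase i, (Γ j / dist (x i) (x j) ^ 2) • (x j - x i)

/-- The configuration has a line of symmetry: the reflection in some line (the line through two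
distinct points `p` and `q`) maps the set of positions onto itself. -/
def HasLineOfSymmetry {n : ℕ} (x : Fin n → Plane) : Prop :=
  ∃ p q : Plane, p ≠ q ∧
    (EuclideanGeometry.reflection (affineSpan ℝ {p, q})) '' Set.range x = Set.range x

/-- The vortex strengths `Γ₁ = Γ₂ = 1`, `Γ₃ = Γ₄ = m`. -/
def strengths (m : ℝ) : Fin 4 → ℝ := ![1, 1, m, m]

/-- The squared mutual distances followed by the parameter, in the order
`(s₁₂, s₁₃, s₁₄, s₂₃, s₂₄, s₃₄, m)`. The four vortices are numbered from `0` in the code. -/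
def coordinates (x : Fin 4 → Plane) (m : ℝ) : Fin 7 → ℝ :=
  ![dist (x 0) (x 1) ^ 2, dist (x 0) (x 2) ^ 2, dist (x 0) (x 3) ^ 2,
    dist (x 1) (x 2) ^ 2, dist (x 1) (x 3) ^ 2, dist (x 2) (x 3) ^ 2, m]

/-- The set of all `(s₁₂, s₁₃, s₁₄, s₂₃, s₂₄, s₃₄, m)` with `-1 < m ≤ 1` coming from strictly
planar (not collinear) relative equilibria with strengths `(1, 1, m, m)` and without any line of
symmetry, where the scale is fixed by `λ' = -ω / Γ = -1`, that is, the angular velocity `ω` is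
the total circulation `Γ = ∑ Γ i`. -/
def asymmetricConfigurations : Set (Fin 7 → ℝ) :=
  {p | ∃ (m : ℝ) (x : Fin 4 → Plane), -1 < m ∧ m ≤ 1 ∧
    IsRelativeEquilibrium (strengths m) (∑ i, strengths m i) x ∧
    ¬ Collinear ℝ (Set.range x) ∧
    ¬ HasLineOfSymmetry x ∧
    p = coordinates x m}

/-! ### The nine polynomials -/

/-- The ring `ℝ[s₁₂, s₁₃, s₁₄, s₂₃, s₂₄, s₃₄, m]`. -/
abbrev Poly : Type := MvPolynomial (Fin 7) ℝ

def s12 : Poly := MvPolynomial.X 0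
def s13 : Poly := MvPolynomial.X 1
def s14 : Poly := MvPolynomial.X 2
def s23 : Poly := MvPolynomial.X 3
def s24 : Poly := MvPolynomial.X 4
def s34 : Poly := MvPolynomial.X 5
def mm : Poly := MvPolynomial.X 6

def f1 : Poly := s13 + s14 + s23 + s24 - 2 * s34 - 1
def f2 : Poly := s12 - s34 + 1
def f3 : Poly := s34 * mm + s34 - mm - 2
def f4 : Poly := 2 * s24 ^ 2 - s14 * s34 - s23 * s34 - 4 * s24 * s34 + 2 * s34 ^ 2 + 2 * s23
def f5 : Poly := 2 * s23 * s24 - 2 * s23 - 2 * s24 + s34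
def f6 : Poly := 2 * s14 * s24 - s34
def f7 : Poly := 2 * s23 ^ 2 + s14 * s34 - 3 * s23 * s34 + 2 * s24 - s34
def f8 : Poly := 2 * s14 * s23 - s14 * s34 - s23 * s34 + s34
def f9 : Poly := 2 * s14 ^ 2 - 3 * s14 * s34 + s23 * s34 - 2 * s14 - 2 * s23 - 2 * s24
  + 3 * s34 + 2

/-- The ideal generated by the nine polynomials. -/
def I : Ideal Poly := Ideal.span {f1, f2, f3, f4, f5, f6, f7, f8, f9}

/-! ### Real ideals and the real radical -/

/-- An ideal is real if `a₁² + ⋯ + aₚ² ∈ J` implies that every `aᵢ ∈ J`. -/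
def IsRealIdeal {A : Type*} [CommRing A] (J : Ideal A) : Prop :=
  ∀ (p : ℕ) (a : Fin p → A), ∑ i, a i ^ 2 ∈ J → ∀ i, a i ∈ J

/-- The real radical: the intersection of all real ideals containing `J`. -/
def realRadical {A : Type*} [CommRing A] (J : Ideal A) : Ideal A :=
  sInf {K | IsRealIdeal K ∧ J ≤ K}

/-- The real radical is the smallest real ideal containing the given one. -/
theorem realRadical_isLeast {A : Type*} [CommRing A] (J : Ideal A) :
    IsLeast {K : Ideal A | IsRealIdeal K ∧ J ≤ K} (realRadical J) := by
  refine ⟨⟨?_, le_sInf fun K hK => hK.2⟩, fun K hK => sInf_le hK⟩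
  intro p a ha i
  rw [realRadical, Submodule.mem_sInf] at ha ⊢
  exact fun K hK => hK.1 p a (ha K hK) i

/-! ### Dimension of an affine variety -/

/-- The affine Hilbert function `s ↦ dim_k (k[x]_{≤ s} / J_{≤ s})`, where `k[x]_{≤ s}` is the
space of polynomials of total degree at most `s`, and `J_{≤ s} = J ∩ k[x]_{≤ s}`. -/
def affineHilbertFunction {σ k : Type*} [Field k] (J : Ideal (MvPolynomial σ k)) (s : ℕ) : ℕ :=
  Module.finrank k
    (↥(MvPolynomial.restrictTotalDegree σ k s) ⧸
      (J.restrictScalars k).submoduleOf (MvPolynomial.restrictTotalDegree σ k s))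

/-- `P` is the affine Hilbert polynomial of `J`: it agrees with the affine Hilbert function at
all sufficiently large integers (which determines `P`). -/
def IsAffineHilbertPolynomial {σ k : Type*} [Field k] (J : Ideal (MvPolynomial σ k))
    (P : Polynomial ℚ) : Prop :=
  ∀ᶠ s : ℕ in Filter.atTop, (affineHilbertFunction J s : ℚ) = P.eval (s : ℚ)

/-- The affine variety `V ⊆ kⁿ` has dimension `d`: the affine Hilbert polynomial of its vanishing
ideal has degree `d`. -/
def HasDimension {n : ℕ} {k : Type*} [Field k] (V : Set (Fin n → k)) (d : ℕ) : Prop :=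
  ∃ P : Polynomial ℚ,
    IsAffineHilbertPolynomial (MvPolynomial.vanishingIdeal k V) P ∧ P.degree = d

end FourVortex

end

/-! The nine equations describe a rational curve. With z = s23 - s14, the ideal contains the
relations z (s24 - s13) = 1 and z² = s14 + s23 - 1, and from these every coordinate becomes a
rational function of z whose only poles are z = 0 and the roots of D = z⁴ - z² + 1. The factor z is
inverted by s24 - s13, and D = 2 z² (s34 - 1), where s34 - 1 is inverted by m + 1. Hence the
quotient by `I` is the localization of ℝ[z] at z D (`exists_univariate`,
`mem_of_mul_poleProduct_pow_mem`). A polynomial that vanishes at infinitely many real points of the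
curve therefore lies in `I`; this gives the vanishing ideal, the Zariski closure and the real
radical together.

For the Hilbert function, a polynomial of degree at most s is restricted to the curve and multiplied
by (z² D)^s. The result has degree at most 8 s, and at the four roots of D only m has a pole, so all
four are sent to the same point at infinity. This forces the numerator to be c z^(4s) modulo D, and
for s ≥ 1 there is no further condition (`numerators_eq_seminormal`). The count is 1 + (8 s - 3) = 8
s - 2, of degree 1 in s.

For the geometry with m ≠ 0, each equation of motion is an affine dependency of the four positions.
Such dependencies are all proportional to the signed areas y, so Γᵢ Γⱼ (1 / sᵢⱼ - 1) = μ yᵢ yⱼ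
(`exists_eq_mul_mul`). Planarity gives that Σⱼ yⱼ sᵢⱼ does not depend on i. Asymmetry excludes y1 =
y2 and y3 = y4 (kites) and y1 + y2 = 0 (isosceles trapezoids). After division by these factors,
elimination leaves (1 - P)(1 - Q) = 0 with P = α y1 y2, Q = α y3 y4 and α = μ / m
(`dziobek_relations`). The case P = 1 is the curve. The case Q = 1 is its image under exchanging the
two pairs, that is m ↦ 1 / m, and is impossible for m ≤ 1. For m = 0 the vortices of strength zero
sit at equilibria of the two-vortex field, which are found directly. Conversely, explicit positions
realize each point of the curve, and they are symmetric only for z = ±1. -/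

open MvPolynomial

noncomputable section

namespace FourVortex

/-! ### The rational parametrization of the curve -/

/-- The rational curve that parametrizes the real zeros of `I`, for `z ≠ 0`. -/
def curvePoint (z : ℝ) : Fin 7 → ℝ :=
  ![(z ^ 4 - z ^ 2 + 1) / (2 * z ^ 2), (z ^ 2 - z + 1) / (2 * z ^ 2), (z ^ 2 - z + 1) / 2,
    (z ^ 2 + z + 1) / 2, (z ^ 2 + z + 1) / (2 * z ^ 2), (z ^ 4 + z ^ 2 + 1) / (2 * z ^ 2),
    2 * z ^ 2 / (z ^ 4 - z ^ 2 + 1) - 1]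

theorem quartic_pos (z : ℝ) : 0 < z ^ 4 - z ^ 2 + 1 := by
  nlinarith [sq_nonneg (z ^ 2 - 1), sq_nonneg z]

theorem aeval_eq_zero_of_mem {B : Type*} [CommRing B] [Algebra ℝ B] {e : Fin 7 → B}
    (h1 : e 1 + e 2 + e 3 + e 4 - 2 * e 5 - 1 = 0) (h2 : e 0 - e 5 + 1 = 0)
    (h3 : e 5 * e 6 + e 5 - e 6 - 2 = 0)
    (h4 : 2 * e 4 ^ 2 - e 2 * e 5 - e 3 * e 5 - 4 * e 4 * e 5 + 2 * e 5 ^ 2 + 2 * e 3 = 0)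
    (h5 : 2 * e 3 * e 4 - 2 * e 3 - 2 * e 4 + e 5 = 0) (h6 : 2 * e 2 * e 4 - e 5 = 0)
    (h7 : 2 * e 3 ^ 2 + e 2 * e 5 - 3 * e 3 * e 5 + 2 * e 4 - e 5 = 0)
    (h8 : 2 * e 2 * e 3 - e 2 * e 5 - e 3 * e 5 + e 5 = 0)
    (h9 : 2 * e 2 ^ 2 - 3 * e 2 * e 5 + e 3 * e 5 - 2 * e 2 - 2 * e 3 - 2 * e 4 + 3 * e 5 + 2 = 0)
    {f : Poly} (hf : f ∈ I) : aeval e f = 0 := by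
  have : I ≤ RingHom.ker (aeval e : Poly →ₐ[ℝ] B) := by
    rw [I, Ideal.span_le]
    rintro g hg
    simp only [Set.mem_insert_iff, Set.mem_singleton_iff] at hg
    rcases hg with rfl | rfl | rfl | rfl | rfl | rfl | rfl | rfl | rfl <;>
      simpa [RingHom.mem_ker, f1, f2, f3, f4, f5, f6, f7, f8, f9, s12, s13, s14, s23, s24, s34, mm]
  exact this hf

theorem curvePoint_mem_zeroLocus {z : ℝ} (hz : z ≠ 0) : curvePoint z ∈ zeroLocus ℝ I := by
  have hD : z ^ 2 * (z ^ 2 - 1) + 1 ≠ 0 := fun h => (quartic_pos z).ne' (by linear_combination h)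
  intro f hf
  refine aeval_eq_zero_of_mem ?_ ?_ ?_ ?_ ?_ ?_ ?_ ?_ ?_ hf <;>
    simp [curvePoint] <;> field_simp <;> ring

/-- The relations that invert the parametrization, in any algebra in which `I` vanishes. -/
theorem curve_relations {B : Type*} [CommRing B] [Algebra ℝ B] {e : Fin 7 → B}
    (he : ∀ f ∈ I, aeval e f = 0) :
    (e 3 - e 2) * (e 4 - e 1) = 1 ∧ 2 * e 2 = (e 3 - e 2) ^ 2 - (e 3 - e 2) + 1 ∧
      e 4 * (e 3 - e 2) ^ 2 = e 3 ∧ e 1 * (e 3 - e 2) ^ 2 = e 2 ∧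
      e 5 = 2 * e 2 * e 4 ∧ e 0 = e 5 - 1 ∧ (e 5 - 1) * (e 6 + 1) = 1 := by
  have hmem : ∀ f ∈ ({f1, f2, f3, f4, f5, f6, f7, f8, f9} : Set Poly), aeval e f = 0 :=
    fun f hf => he f (Ideal.subset_span hf)
  simp only [Set.mem_insert_iff, Set.mem_singleton_iff, forall_eq_or_imp, forall_eq] at hmem
  simp only [f1, f2, f3, f4, f5, f6, f7, f8, f9, s12, s13, s14, s23, s24, s34, mm, map_add,
    map_sub, map_mul, map_pow, aeval_X, map_ofNat, map_one] at hmem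
  obtain ⟨h1, h2, h3, -, h5, h6, h7, h8, h9⟩ := hmem
  -- The factor 2 is invertible because `B` is a real algebra.
  have two : ∀ x : B, 2 * x = 0 → x = 0 := by
    intro x hx
    have : algebraMap ℝ B (1 / 2) * 2 = 1 := by
      rw [← map_ofNat (algebraMap ℝ B), ← map_mul]; norm_num
    linear_combination algebraMap ℝ B (1 / 2) * hx - x * this
  have hZW : (e 3 - e 2) * (e 4 - e 1) = 1 := by
    apply sub_eq_zero.1 (two _ _)
    linear_combination (-2 * (e 3 - e 2)) * h1 + 2 * h5 - 2 * h6 + h7 - h9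
  have hZ2 : (e 3 - e 2) ^ 2 = e 2 + e 3 - 1 := by
    apply sub_eq_zero.1 (two _ _)
    linear_combination h7 + h9 - 2 * h8
  have h4 : e 4 * (e 3 - e 2) ^ 2 = e 3 := by
    apply sub_eq_zero.1 (two _ _)
    rw [hZ2]
    linear_combination h5 + h6
  refine ⟨hZW, ?_, h4, ?_, ?_, ?_, ?_⟩
  · rw [hZ2]; ring
  · linear_combination h4 - (e 3 - e 2) * hZW
  · linear_combination - h6
  · linear_combination h2
  · linear_combination h3

/-- The parameter is recovered as s23 - s14, which is nonzero because s24 - s13 is its inverse; the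
relations then determine the other coordinates one by one. -/
theorem zeroLocus_eq_image : zeroLocus ℝ I = curvePoint '' {0}ᶜ := by
  ext p
  constructor
  · intro hp
    obtain ⟨hZW, h2, h4, h1, h5, h0, h6⟩ := curve_relations hp
    have hz : p 3 - p 2 ≠ 0 := left_ne_zero_of_mul_eq_one hZW
    set z := p 3 - p 2 with hzdef
    have h2' : p 2 = (z ^ 2 - z + 1) / 2 := by linarith
    have h3' : p 3 = (z ^ 2 + z + 1) / 2 := by linarith
    have h4' : p 4 = (z ^ 2 + z + 1) / (2 * z ^ 2) := by
      rw [eq_div_iff (by positivity)]; linear_combination 2 * h4 + 2 * h3'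
    have h1' : p 1 = (z ^ 2 - z + 1) / (2 * z ^ 2) := by
      rw [eq_div_iff (by positivity)]; linear_combination 2 * h1 + 2 * h2'
    have h5' : p 5 = (z ^ 4 + z ^ 2 + 1) / (2 * z ^ 2) := by
      rw [h5, h2', h4']; field_simp; ring
    have h0' : p 0 = (z ^ 4 - z ^ 2 + 1) / (2 * z ^ 2) := by
      rw [h0, h5']; field_simp; ring
    have h6' : p 6 = 2 * z ^ 2 / (z ^ 4 - z ^ 2 + 1) - 1 := by
      rw [← h0, h0', div_mul_eq_mul_div, div_eq_one_iff_eq (by positivity)] at h6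
      rw [eq_sub_iff_add_eq, eq_div_iff (quartic_pos z).ne', mul_comm, h6]
    refine ⟨z, hz, ?_⟩
    ext i
    fin_cases i
    exacts [h0'.symm, h1'.symm, h2'.symm, h3'.symm, h4'.symm, h5'.symm, h6'.symm]
  · rintro ⟨z, hz, rfl⟩
    exact curvePoint_mem_zeroLocus hz

/-! ### The coordinate ring -/

/-- The polynomial whose zeros are the poles of the parametrization. -/
def poleProduct : Polynomial ℝ :=
  Polynomial.X * (Polynomial.X ^ 4 - Polynomial.X ^ 2 + 1)

/-- Up to a power of the pole product, which is invertible modulo `I`, every polynomial is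
congruent to a univariate polynomial in `s23 - s14`. -/
theorem exists_univariate (f : Poly) : ∃ (n : ℕ) (p : Polynomial ℝ),
    f * Polynomial.aeval (s23 - s14) poleProduct ^ n - Polynomial.aeval (s23 - s14) p ∈ I := by
  set mk : Poly →ₐ[ℝ] Poly ⧸ I := Ideal.Quotient.mkₐ ℝ I with hmkdef
  set e : Fin 7 → Poly ⧸ I := fun i => mk (X i) with hedef
  have hmk : mk = aeval e := aeval_unique mk
  have he : ∀ f ∈ I, aeval e f = 0 := fun f hf => by
    rw [← hmk]; exact Ideal.Quotient.eq_zero_iff_mem.2 hf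
  obtain ⟨hZW, h2, h4, h1, h5, h0, h6⟩ := curve_relations he
  set z := e 3 - e 2 with hz
  set q := Polynomial.aeval z poleProduct with hq
  have hq' : q = z * (z ^ 4 - z ^ 2 + 1) := by simp [hq, poleProduct]
  -- The elements that become univariate after multiplication by a power of `q` form a subalgebra,
  -- so only the seven coordinates need to be checked.
  set H : Poly ⧸ I → Prop := fun x => ∃ (n : ℕ) (p : Polynomial ℝ),
    x * q ^ n = Polynomial.aeval z p with hH
  have Hp : ∀ p : Polynomial ℝ, H (Polynomial.aeval z p) := fun p => ⟨0, p, by simp⟩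
  have Hadd : ∀ x y, H x → H y → H (x + y) := by
    rintro x y ⟨n, p, hp⟩ ⟨k, r, hr⟩
    refine ⟨n + k, p * poleProduct ^ k + r * poleProduct ^ n, ?_⟩
    rw [map_add, map_mul, map_mul, map_pow, map_pow, ← hp, ← hr, ← hq]
    ring
  have Hmul : ∀ x y, H x → H y → H (x * y) := by
    rintro x y ⟨n, p, hp⟩ ⟨k, r, hr⟩
    refine ⟨n + k, p * r, ?_⟩
    rw [map_mul, ← hp, ← hr]
    ring
  have HC : ∀ c : ℝ, H (algebraMap ℝ _ c) := fun c => by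
    simpa using Hp (Polynomial.C c)
  have Hz : H z := by simpa using Hp Polynomial.X
  have H2 : H (e 2) := by
    have : e 2 = algebraMap ℝ _ (1 / 2) * Polynomial.aeval z
        (Polynomial.X ^ 2 - Polynomial.X + 1 : Polynomial ℝ) := by
      have half : algebraMap ℝ (Poly ⧸ I) (1 / 2) * 2 = 1 := by
        rw [← map_ofNat (algebraMap ℝ (Poly ⧸ I)), ← map_mul]; norm_num
      simp only [map_add, map_sub, map_pow, Polynomial.aeval_X, map_one, ← h2]
      linear_combination - e 2 * half
    rw [this]
    exact Hmul _ _ (HC _) (Hp _)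
  have HW : H (e 4 - e 1) := ⟨1, Polynomial.X ^ 4 - Polynomial.X ^ 2 + 1, by
    simp only [pow_one, hq', map_add, map_sub, map_pow, Polynomial.aeval_X, map_one]
    linear_combination (z ^ 4 - z ^ 2 + 1) * hZW⟩
  have H3 : H (e 3) := by
    have : e 3 = e 2 + z := by rw [hz]; ring
    rw [this]
    exact Hadd _ _ H2 Hz
  have H4 : H (e 4) := by
    -- Here `e 4 - e 1` is the inverse of `z`, and `e 4 * z ^ 2 = e 3`.
    have : e 4 = e 3 * ((e 4 - e 1) * (e 4 - e 1)) := by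
      linear_combination (e 4 - e 1) ^ 2 * h4 - e 4 * (z * (e 4 - e 1) + 1) * hZW
    rw [this]
    exact Hmul _ _ H3 (Hmul _ _ HW HW)
  have H1 : H (e 1) := by
    have : e 1 = e 4 + algebraMap ℝ _ (-1) * (e 4 - e 1) := by rw [map_neg, map_one]; ring
    rw [this]
    exact Hadd _ _ H4 (Hmul _ _ (HC _) HW)
  have H5 : H (e 5) := by
    have : e 5 = (e 2 + e 2) * e 4 := by rw [h5]; ring
    rw [this]
    exact Hmul _ _ (Hadd _ _ H2 H2) H4
  have H0 : H (e 0) := by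
    have : e 0 = e 5 + algebraMap ℝ _ (-1) := by rw [h0]; simp [sub_eq_add_neg]
    rw [this]
    exact Hadd _ _ H5 (HC _)
  have H6 : H (e 6) := by
    -- On the curve m = 2 z² / D - 1, so multiplication by z D gives z (2 z² - D).
    refine ⟨1, Polynomial.X * (2 * Polynomial.X ^ 2 - (Polynomial.X ^ 4 - Polynomial.X ^ 2 + 1)), ?_⟩
    have h4' : 2 * e 4 * z ^ 2 = z ^ 2 + z + 1 := by linear_combination 2 * h4 + h2 - 2 * hz
    have h5' : 2 * (e 5 - 1) * z ^ 2 = z ^ 4 - z ^ 2 + 1 := by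
      rw [h5]
      linear_combination 2 * e 2 * h4' + (z ^ 2 + z + 1) * h2
    simp only [pow_one, hq', map_add, map_sub, map_mul, map_pow, Polynomial.aeval_X, map_one,
      map_ofNat]
    linear_combination 2 * z ^ 3 * h6 - z * (e 6 + 1) * h5'
  have key : H (mk f) := by
    induction f using MvPolynomial.induction_on with
    | C a => simpa [hmk] using HC a
    | add p r hp hr => rw [map_add]; exact Hadd _ _ hp hr
    | mul_X p i hp =>
      rw [map_mul]
      refine Hmul _ _ hp ?_
      fin_cases i
      exacts [H0, H1, H2, H3, H4, H5, H6]
  obtain ⟨n, p, hp⟩ := key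
  refine ⟨n, p, ?_⟩
  have hz' : mk (s23 - s14) = z := by rw [map_sub]; rfl
  have hsub : ∀ r : Polynomial ℝ,
      mk (Polynomial.aeval (s23 - s14) r) = Polynomial.aeval z r := fun r => by
    rw [← hz', Polynomial.aeval_algHom_apply]
  rw [← Ideal.Quotient.eq_zero_iff_mem]
  change mk _ = 0
  rw [map_sub, map_mul, map_pow, hsub, hsub, ← hq, hp, sub_self]

/-- The pole product is invertible modulo `I`. -/
theorem mem_of_mul_poleProduct_pow_mem {f : Poly} {n : ℕ}
    (h : f * Polynomial.aeval (s23 - s14) poleProduct ^ n ∈ I) : f ∈ I := by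
  set mk : Poly →ₐ[ℝ] Poly ⧸ I := Ideal.Quotient.mkₐ ℝ I with hmkdef
  set e : Fin 7 → Poly ⧸ I := fun i => mk (X i) with hedef
  have hmk : mk = aeval e := aeval_unique mk
  have he : ∀ f ∈ I, aeval e f = 0 := fun f hf => by
    rw [← hmk]; exact Ideal.Quotient.eq_zero_iff_mem.2 hf
  obtain ⟨hZW, h2, h4, -, h5, -, h6⟩ := curve_relations he
  set z := e 3 - e 2 with hz
  have hz' : mk (s23 - s14) = z := by rw [map_sub]; rfl
  have hq : mk (Polynomial.aeval (s23 - s14) poleProduct) = z * (z ^ 4 - z ^ 2 + 1) := by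
    rw [← Polynomial.aeval_algHom_apply, hz']; simp [poleProduct]
  -- Each factor of z D has an explicit inverse: D = 2 (s34 - 1) z², with s34 - 1 inverse to m + 1
  -- and z inverse to s24 - s13.
  have hunit : IsUnit (mk (Polynomial.aeval (s23 - s14) poleProduct)) := by
    have h4' : 2 * e 4 * z ^ 2 = z ^ 2 + z + 1 := by linear_combination 2 * h4 + h2 - 2 * hz
    have h5' : 2 * (e 5 - 1) * z ^ 2 = z ^ 4 - z ^ 2 + 1 := by
      rw [h5]
      linear_combination 2 * e 2 * h4' + (z ^ 2 + z + 1) * h2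
    have hu2 : IsUnit (2 : Poly ⧸ I) := by
      have : IsUnit (algebraMap ℝ (Poly ⧸ I) 2) := (isUnit_iff_ne_zero.2 two_ne_zero).map _
      rwa [map_ofNat] at this
    have huz : IsUnit z := IsUnit.of_mul_eq_one _ hZW
    have hu5 : IsUnit (e 5 - 1) := IsUnit.of_mul_eq_one _ h6
    rw [hq, ← h5']
    exact huz.mul ((hu2.mul hu5).mul (huz.pow 2))
  rw [← Ideal.Quotient.eq_zero_iff_mem] at h ⊢
  change mk _ = 0 at h
  change mk _ = 0
  rw [map_mul, map_pow] at h
  exact (hunit.pow n).mul_left_eq_zero.1 h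

theorem aeval_curvePoint_univariate (z : ℝ) (p : Polynomial ℝ) :
    aeval (curvePoint z) (Polynomial.aeval (s23 - s14) p) = p.eval z := by
  rw [← Polynomial.aeval_algHom_apply]
  have : aeval (curvePoint z) (s23 - s14) = z := by
    simp [s23, s14, curvePoint]; ring
  rw [this, Polynomial.coe_aeval_eq_eval]

/-- A polynomial that vanishes at infinitely many points of the curve belongs to `I`. -/
theorem mem_of_vanishes_on_infinite {S : Set ℝ} (hS : S.Infinite) (h0 : ∀ z ∈ S, z ≠ 0) {f : Poly}
    (hf : ∀ z ∈ S, aeval (curvePoint z) f = 0) : f ∈ I := by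
  obtain ⟨n, p, hp⟩ := exists_univariate f
  have hp0 : p = 0 := by
    refine Polynomial.eq_zero_of_infinite_isRoot p (hS.mono fun z hz => ?_)
    have := curvePoint_mem_zeroLocus (h0 z hz) _ hp
    rw [map_sub, map_mul, hf z hz, zero_mul, zero_sub, neg_eq_zero,
      aeval_curvePoint_univariate] at this
    exact this
  rw [hp0, map_zero, sub_zero] at hp
  exact mem_of_mul_poleProduct_pow_mem hp

theorem vanishingIdeal_zeroLocus_I : vanishingIdeal ℝ (zeroLocus ℝ I) = I := by
  refine le_antisymm (fun f hf => ?_) (le_vanishingIdeal_zeroLocus I)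
  refine mem_of_vanishes_on_infinite (S := {0}ᶜ) (Set.finite_singleton 0).infinite_compl
    (fun z hz => hz) fun z hz => ?_
  exact mem_vanishingIdeal_iff.1 hf _ (curvePoint_mem_zeroLocus hz)

/-- Removing finitely many points from the curve does not change its Zariski closure. -/
theorem vanishingIdeal_zeroLocus_diff {T : Set (Fin 7 → ℝ)} (hT : T.Finite) :
    vanishingIdeal ℝ (zeroLocus ℝ I \ T) = I := by
  refine le_antisymm (fun f hf => ?_) ((le_vanishingIdeal_zeroLocus I).trans
    (vanishingIdeal_anti_mono Set.sdiff_subset))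
  have hinj : Function.Injective curvePoint := fun a b h => by
    have h3 := congrFun h 3
    have h2 := congrFun h 2
    simp only [curvePoint, Matrix.cons_val] at h3 h2
    linarith
  have hfin : ({0} ∪ curvePoint ⁻¹' T).Finite :=
    (Set.finite_singleton 0).union (hT.preimage hinj.injOn)
  refine mem_of_vanishes_on_infinite hfin.infinite_compl
    (fun z hz => fun h => hz (Or.inl h)) fun z hz => ?_
  exact mem_vanishingIdeal_iff.1 hf _
    ⟨curvePoint_mem_zeroLocus fun h => hz (Or.inl h), fun h => hz (Or.inr h)⟩

theorem isRealIdeal_vanishingIdeal {n : ℕ} (V : Set (Fin n → ℝ)) :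
    IsRealIdeal (vanishingIdeal ℝ V) := by
  intro k a ha i
  rw [mem_vanishingIdeal_iff] at ha ⊢
  intro x hx
  have h := ha x hx
  simp only [map_sum, map_pow] at h
  rw [Finset.sum_eq_zero_iff_of_nonneg fun j _ => sq_nonneg _] at h
  exact pow_eq_zero_iff two_ne_zero |>.1 (h i (Finset.mem_univ i))

/-- As the vanishing ideal of a set of real points, `I` is already a real ideal. -/
theorem realRadical_I : realRadical I = I :=
  le_antisymm ((realRadical_isLeast I).2
    ⟨vanishingIdeal_zeroLocus_I ▸ isRealIdeal_vanishingIdeal _, le_rfl⟩)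
    (realRadical_isLeast I).1.2

/-! ### The Hilbert polynomial -/

/-- The quartic whose roots are the poles of the parametrization away from `0`. -/
def quartic : Polynomial ℝ := Polynomial.X ^ 4 - Polynomial.X ^ 2 + 1

theorem quartic_monic : quartic.Monic := by
  unfold quartic; monicity!

theorem natDegree_quartic : quartic.natDegree = 4 := by
  unfold quartic; compute_degree!

theorem eval_quartic (z : ℝ) : quartic.eval z = z ^ 4 - z ^ 2 + 1 := by simp [quartic]

/-- The univariate polynomials `z ^ (2 s) D(z) ^ s f(γ(z))`, where `γ` is the parametrization of the
curve, `D` the quartic of its poles and `f` has degree at most `s`. -/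
def numerators (s : ℕ) : Submodule ℝ (Polynomial ℝ) where
  carrier := {p | ∃ f : Poly, f.totalDegree ≤ s ∧
    ∀ z ≠ 0, p.eval z = z ^ (2 * s) * (z ^ 4 - z ^ 2 + 1) ^ s * aeval (curvePoint z) f}
  add_mem' := by
    rintro p q ⟨f, hf, hp⟩ ⟨g, hg, hq⟩
    refine ⟨f + g, (totalDegree_add f g).trans (max_le hf hg), fun z hz => ?_⟩
    rw [Polynomial.eval_add, hp z hz, hq z hz, map_add]; ring
  zero_mem' := ⟨0, by simp, by simp⟩
  smul_mem' := by
    rintro c p ⟨f, hf, hp⟩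
    refine ⟨c • f, (totalDegree_smul_le c f).trans hf, fun z hz => ?_⟩
    rw [Polynomial.eval_smul, hp z hz, map_smul, smul_eq_mul, smul_eq_mul]; ring

theorem mul_mem_numerators {s t : ℕ} {p q : Polynomial ℝ} (hp : p ∈ numerators s)
    (hq : q ∈ numerators t) : p * q ∈ numerators (s + t) := by
  obtain ⟨f, hf, hp⟩ := hp
  obtain ⟨g, hg, hq⟩ := hq
  refine ⟨f * g, (totalDegree_mul f g).trans (add_le_add hf hg), fun z hz => ?_⟩
  rw [Polynomial.eval_mul, hp z hz, hq z hz, map_mul]; ring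

theorem pow_mem_numerators {p : Polynomial ℝ} (hp : p ∈ numerators 1) (s : ℕ) :
    p ^ s ∈ numerators s := by
  induction s with
  | zero => exact ⟨1, by simp, by simp⟩
  | succ s ih => rw [pow_succ]; exact mul_mem_numerators ih hp

/-- The polynomials of degree at most `8 s` that are congruent to a multiple of `z ^ (4 s)` modulo
the quartic. -/
def seminormal (s : ℕ) : Submodule ℝ (Polynomial ℝ) where
  carrier := {p | p.natDegree ≤ 8 * s ∧
    ∃ c : ℝ, quartic ∣ p - Polynomial.C c * Polynomial.X ^ (4 * s)}
  add_mem' := by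
    rintro p q ⟨hp, c, hc⟩ ⟨hq, d, hd⟩
    refine ⟨(Polynomial.natDegree_add_le _ _).trans (max_le hp hq), c + d, ?_⟩
    convert dvd_add hc hd using 1
    rw [Polynomial.C_add]; ring
  zero_mem' := ⟨by simp, 0, by simp⟩
  smul_mem' := by
    rintro a p ⟨hp, c, hc⟩
    refine ⟨(Polynomial.natDegree_smul_le _ _).trans hp, a * c, ?_⟩
    convert hc.mul_left (Polynomial.C a) using 1
    rw [Polynomial.smul_eq_C_mul, Polynomial.C_mul]; ring

theorem mul_mem_seminormal {s t : ℕ} {p q : Polynomial ℝ} (hp : p ∈ seminormal s)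
    (hq : q ∈ seminormal t) : p * q ∈ seminormal (s + t) := by
  obtain ⟨hp, c, hc⟩ := hp
  obtain ⟨hq, d, hd⟩ := hq
  refine ⟨Polynomial.natDegree_mul_le.trans (by omega), c * d, ?_⟩
  convert dvd_add (hc.mul_right q) (hd.mul_left (Polynomial.C c * Polynomial.X ^ (4 * s))) using 1
  rw [Polynomial.C_mul]; ring

theorem mem_seminormal_of_quartic_dvd {s : ℕ} {p : Polynomial ℝ} (hp : p.natDegree ≤ 8 * s)
    (h : quartic ∣ p) : p ∈ seminormal s := ⟨hp, 0, by simpa using h⟩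

theorem X_pow_mem_seminormal (s : ℕ) : (Polynomial.X ^ (4 * s) : Polynomial ℝ) ∈ seminormal s :=
  ⟨by rw [Polynomial.natDegree_X_pow]; omega, 1, by simp⟩

/-- The squared distances have poles only at 0 and infinity, of order at most 2, so their numerators
are multiples of the quartic. Only m contributes a remainder: z² D m = 2 z⁴ - z² D. -/
theorem exists_seminormal_coordinate (i : Fin 7) : ∃ p ∈ seminormal 1, ∀ z ≠ 0,
    p.eval z = z ^ 2 * (z ^ 4 - z ^ 2 + 1) * curvePoint z i := by
  have hdvd : ∀ r : Polynomial ℝ, r.natDegree ≤ 4 → quartic * r ∈ seminormal 1 := fun r hr => by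
    refine mem_seminormal_of_quartic_dvd (Polynomial.natDegree_mul_le.trans ?_) (dvd_mul_right _ _)
    rw [natDegree_quartic]; omega
  have key : ∀ (r : Polynomial ℝ) (i : Fin 7), r.natDegree ≤ 4 →
      (∀ z ≠ 0, r.eval z = z ^ 2 * curvePoint z i) → ∃ p ∈ seminormal 1, ∀ z ≠ 0,
        p.eval z = z ^ 2 * (z ^ 4 - z ^ 2 + 1) * curvePoint z i := fun r i hr h =>
    ⟨_, hdvd r hr, fun z hz => by rw [Polynomial.eval_mul, eval_quartic, h z hz]; ring⟩
  have hc : ∀ (c a₀ a₁ a₂ a₃ a₄ : ℝ), (Polynomial.C c * (Polynomial.C a₀ +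
      Polynomial.C a₁ * Polynomial.X + Polynomial.C a₂ * Polynomial.X ^ 2 +
      Polynomial.C a₃ * Polynomial.X ^ 3 + Polynomial.C a₄ * Polynomial.X ^ 4)).natDegree ≤ 4 := by
    intro c a₀ a₁ a₂ a₃ a₄
    compute_degree
  fin_cases i
  · exact key _ _ (hc (1 / 2) 1 0 (-1) 0 1) fun z hz => by
      simp [curvePoint]; field_simp; ring
  · exact key _ _ (hc (1 / 2) 1 (-1) 1 0 0) fun z hz => by
      simp [curvePoint]; field_simp; ring
  · exact key _ _ (hc (1 / 2) 0 0 1 (-1) 1) fun z hz => by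
      simp [curvePoint]; field_simp; ring
  · exact key _ _ (hc (1 / 2) 0 0 1 1 1) fun z hz => by
      simp [curvePoint]; field_simp; ring
  · exact key _ _ (hc (1 / 2) 1 1 1 0 0) fun z hz => by
      simp [curvePoint]; field_simp; ring
  · exact key _ _ (hc (1 / 2) 1 0 1 0 1) fun z hz => by
      simp [curvePoint]; field_simp; ring
  · refine ⟨(2 : ℝ) • Polynomial.X ^ (4 * 1) - quartic * Polynomial.X ^ 2,
      Submodule.sub_mem _ (Submodule.smul_mem _ _ (X_pow_mem_seminormal 1))
        (hdvd _ (by simp)), fun z _ => ?_⟩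
    have hD := (quartic_pos z).ne'
    simp only [Polynomial.eval_sub, Polynomial.eval_smul, Polynomial.eval_pow, Polynomial.eval_X,
      Polynomial.eval_mul, eval_quartic, smul_eq_mul, curvePoint, Matrix.cons_val, Fin.reduceFinMk]
    linear_combination -z ^ 2 * div_mul_cancel₀ (2 * z ^ 2) hD

theorem one_mem_seminormal_one : ∃ p ∈ seminormal 1, ∀ z : ℝ,
    p.eval z = z ^ 2 * (z ^ 4 - z ^ 2 + 1) := by
  refine ⟨quartic * Polynomial.X ^ 2, mem_seminormal_of_quartic_dvd
    (Polynomial.natDegree_mul_le.trans ?_) (dvd_mul_right _ _), fun z => ?_⟩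
  · rw [natDegree_quartic, Polynomial.natDegree_X_pow]; omega
  · simp [eval_quartic]; ring

/-- Every polynomial of degree at most `s` has its numerator in `seminormal s`. -/
theorem exists_seminormal {s : ℕ} {f : Poly} (hf : f.totalDegree ≤ s) : ∃ p ∈ seminormal s,
    ∀ z ≠ 0, p.eval z = z ^ (2 * s) * (z ^ 4 - z ^ 2 + 1) ^ s * aeval (curvePoint z) f := by
  -- Numerators of the constant 1, which pad monomials of degree less than s.
  have hone : ∀ s, ∃ p ∈ seminormal s, ∀ z ≠ 0,
      p.eval z = z ^ (2 * s) * (z ^ 4 - z ^ 2 + 1) ^ s := by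
    intro s
    induction s with
    | zero => exact ⟨1, by simpa using X_pow_mem_seminormal 0, by simp⟩
    | succ s ih =>
      obtain ⟨p, hp, h⟩ := ih
      obtain ⟨q, hq, h'⟩ := one_mem_seminormal_one
      refine ⟨p * q, mul_mem_seminormal hp hq, fun z hz => ?_⟩
      rw [Polynomial.eval_mul, h z hz, h']; ring
  have hmon : ∀ (d : Multiset (Fin 7)) (k : ℕ), d.card ≤ k → ∃ p ∈ seminormal k, ∀ z ≠ 0,
      p.eval z = z ^ (2 * k) * (z ^ 4 - z ^ 2 + 1) ^ k * (d.map (curvePoint z)).prod := by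
    intro d
    induction d using Multiset.induction_on with
    | empty => intro k _; simpa using hone k
    | cons i d ih =>
      intro k hk
      rw [Multiset.card_cons] at hk
      obtain ⟨k, rfl⟩ : ∃ l, k = l + 1 := ⟨k - 1, by omega⟩
      obtain ⟨p, hp, h⟩ := ih k (by omega)
      obtain ⟨q, hq, h'⟩ := exists_seminormal_coordinate i
      refine ⟨p * q, mul_mem_seminormal hp hq, fun z hz => ?_⟩
      rw [Polynomial.eval_mul, h z hz, h' z hz, Multiset.map_cons, Multiset.prod_cons]; ring
  have hterm : ∀ d ∈ f.support, ∃ p ∈ seminormal s, ∀ z ≠ 0, p.eval z =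
      z ^ (2 * s) * (z ^ 4 - z ^ 2 + 1) ^ s * aeval (curvePoint z) (monomial d (coeff d f)) := by
    intro d hd
    obtain ⟨p, hp, h⟩ := hmon (Finsupp.toMultiset d) s (by
      rw [Finsupp.card_toMultiset]; exact (le_totalDegree hd).trans hf)
    refine ⟨coeff d f • p, Submodule.smul_mem _ _ hp, fun z hz => ?_⟩
    rw [Polynomial.eval_smul, h z hz, aeval_monomial, smul_eq_mul, Finsupp.toMultiset_map,
      Finsupp.prod_toMultiset, Finsupp.prod_mapDomain_index (by simp) (by simp [pow_add])]
    simp only [Algebra.algebraMap_self, RingHom.id_apply]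
    ring
  choose! p hp h using hterm
  refine ⟨∑ d ∈ f.support, p d, Submodule.sum_mem _ hp, fun z hz => ?_⟩
  rw [Polynomial.eval_finsetSum, Finset.sum_congr rfl fun d hd => h d hd z hz, ← Finset.mul_sum,
    ← map_sum, ← f.as_sum]

theorem numerators_le_seminormal (s : ℕ) : numerators s ≤ seminormal s := by
  rintro p ⟨f, hf, hp⟩
  obtain ⟨q, hq, h⟩ := exists_seminormal hf
  have : p = q := Polynomial.eq_of_infinite_eval_eq p q
    ((Set.finite_singleton (0 : ℝ)).infinite_compl.mono fun z hz => by
      change p.eval z = q.eval z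
      rw [hp z hz, h z hz])
  rwa [this]

/-- If all but one of the terms of a sum of shifts lie in a submodule, then so does the last. -/
theorem mul_X_pow_mem_of_forall_ne {M : Submodule ℝ (Polynomial ℝ)} {p q : Polynomial ℝ}
    {a n i : ℕ} (hp : p.natDegree ≤ n) (hi : i ≤ n) (hpi : p.coeff i = 1)
    (h : q * p * Polynomial.X ^ a ∈ M)
    (hM : ∀ j ≤ n, j ≠ i → q * Polynomial.X ^ (a + j) ∈ M) :
    q * Polynomial.X ^ (a + i) ∈ M := by
  have hsum : q * p * Polynomial.X ^ a =
      ∑ j ∈ Finset.range (n + 1), p.coeff j • (q * Polynomial.X ^ (a + j)) := by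
    conv_lhs => rw [p.as_sum_range_C_mul_X_pow' (Nat.lt_succ_of_le hp)]
    rw [Finset.mul_sum, Finset.sum_mul]
    refine Finset.sum_congr rfl fun j _ => ?_
    rw [Polynomial.smul_eq_C_mul]; ring
  rw [hsum, ← Finset.add_sum_erase _ _ (Finset.mem_range.2 (Nat.lt_succ_of_le hi)), hpi,
    one_smul] at h
  refine (Submodule.add_mem_iff_left _ (Submodule.sum_mem _ fun j hj => ?_)).1 h
  rw [Finset.mem_erase, Finset.mem_range] at hj
  exact Submodule.smul_mem _ _ (hM j (by omega) hj.1)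

/-- Since (m + 1) / 2 = z² / D, its numerator is exactly z⁴. -/
theorem X_pow_four_mem_numerators : (Polynomial.X ^ 4 : Polynomial ℝ) ∈ numerators 1 := by
  refine ⟨(1 / 2 : ℝ) • (mm + 1), ?_, fun z _ => ?_⟩
  · rw [← mem_restrictTotalDegree]
    refine Submodule.smul_mem _ _ (Submodule.add_mem _ ?_ ?_) <;>
      simp [mem_restrictTotalDegree, mm]
  · have hD := (quartic_pos z).ne'
    simp only [mm, map_smul, map_add, aeval_X, map_one, curvePoint, Matrix.cons_val,
      Polynomial.eval_pow, Polynomial.eval_X, smul_eq_mul]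
    linear_combination (-z ^ 2 / 2) * div_mul_cancel₀ (2 * z ^ 2) hD

/-- The functions z⁻², z⁻¹, 1, z, z² are all affine combinations of the coordinates s13, s14, s23,
s24. -/
theorem quartic_mul_X_pow_mem_numerators {j : ℕ} (hj : j ≤ 4) :
    quartic * Polynomial.X ^ j ∈ numerators 1 := by
  have hX : ∀ i : Fin 7, (X i : Poly) ∈ restrictTotalDegree (Fin 7) ℝ 1 := fun i => by
    simp [mem_restrictTotalDegree]
  have h1 : (1 : Poly) ∈ restrictTotalDegree (Fin 7) ℝ 1 := by simp [mem_restrictTotalDegree]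
  have key : ∀ f ∈ restrictTotalDegree (Fin 7) ℝ 1,
      (∀ z ≠ 0, z ^ j = z ^ 2 * aeval (curvePoint z) f) →
      quartic * Polynomial.X ^ j ∈ numerators 1 := fun f hf h =>
    ⟨f, (mem_restrictTotalDegree _ _ _).1 hf, fun z hz => by
      rw [Polynomial.eval_mul, eval_quartic, Polynomial.eval_pow, Polynomial.eval_X, h z hz]; ring⟩
  interval_cases j
  · refine key (X 1 + X 4 - 1) (sub_mem (add_mem (hX _) (hX _)) h1) fun z hz => ?_
    simp [curvePoint]; field_simp; ring
  · refine key (X 4 - X 1) (sub_mem (hX _) (hX _)) fun z hz => ?_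
    simp [curvePoint]; field_simp; ring
  · exact key 1 h1 fun z hz => by simp
  · refine key (X 3 - X 2) (sub_mem (hX _) (hX _)) fun z hz => ?_
    simp [curvePoint]; field_simp; ring
  · refine key (X 2 + X 3 - 1) (sub_mem (add_mem (hX _) (hX _)) h1) fun z hz => ?_
    simp [curvePoint]; field_simp; ring

theorem quartic_pow_mul_X_pow_mem_numerators (r : ℕ) : ∀ j ≤ 4 * r,
    quartic ^ r * Polynomial.X ^ j ∈ numerators r := by
  induction r with
  | zero => intro j hj; obtain rfl : j = 0 := by omega
            exact ⟨1, by simp, by simp⟩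
  | succ r ih =>
    intro j hj
    have h := mul_mem_numerators (ih (j - min j 4) (by omega))
      (quartic_mul_X_pow_mem_numerators (min_le_right j 4))
    have e : quartic ^ (r + 1) * Polynomial.X ^ j =
        quartic ^ r * Polynomial.X ^ (j - min j 4) * (quartic * Polynomial.X ^ min j 4) := by
      nth_rw 1 [show j = (j - min j 4) + min j 4 by omega]
      rw [pow_add]; ring
    rwa [e]

/-- A product of r numerators of the form D zʲ with s - r copies of z⁴. -/
theorem quartic_pow_mul_X_pow_mem_numerators' {r s b : ℕ} (hr : r ≤ s) (hb : 4 * s ≤ b + 4 * r)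
    (hb' : b ≤ 4 * s) : quartic ^ r * Polynomial.X ^ b ∈ numerators s := by
  have h := mul_mem_numerators (pow_mem_numerators X_pow_four_mem_numerators (s - r))
    (quartic_pow_mul_X_pow_mem_numerators r (b - 4 * (s - r)) (by omega))
  rw [Nat.sub_add_cancel hr] at h
  have e : quartic ^ r * Polynomial.X ^ b = (Polynomial.X ^ 4) ^ (s - r) *
      (quartic ^ r * Polynomial.X ^ (b - 4 * (s - r))) := by
    nth_rw 1 [show b = 4 * (s - r) + (b - 4 * (s - r)) by omega]
    rw [pow_add, pow_mul]; ring
  rwa [e]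

/-- A single factor D with exponents in a window around 4 s that widens by 4 on each side as r
grows. The new numerators D^(r+1) z^a expand into shifts D z^(a+j), of which all but one extreme
term are already known. At r = s the window is 0 ≤ b ≤ 8 s - 4. -/
theorem quartic_mul_X_pow_mem_numerators_of_le {s r : ℕ} (hr : 1 ≤ r) (hrs : r ≤ s) :
    ∀ b, 4 * s ≤ b + 4 * r → b + 4 ≤ 4 * s + 4 * r →
      quartic * Polynomial.X ^ b ∈ numerators s := by
  induction r, hr using Nat.le_induction with
  | base => intro b h1 h2
            simpa using quartic_pow_mul_X_pow_mem_numerators' (r := 1) hrs h1 (by omega)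
  | succ r hr ih =>
    have hdeg : (quartic ^ r).natDegree = 4 * r := by
      rw [quartic_monic.natDegree_pow, natDegree_quartic, mul_comm]
    have h0 : (quartic ^ r).coeff 0 = 1 := by
      rw [Polynomial.coeff_zero_eq_eval_zero, Polynomial.eval_pow, eval_quartic]; simp
    have htop : (quartic ^ r).coeff (4 * r) = 1 := by
      rw [← hdeg]; exact quartic_monic.pow r
    have hpow : ∀ a, 4 * s ≤ a + 4 * (r + 1) → a ≤ 4 * s →
        quartic * quartic ^ r * Polynomial.X ^ a ∈ numerators s := fun a h1 h2 => by
      rw [← pow_succ']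
      exact quartic_pow_mul_X_pow_mem_numerators' hrs h1 h2
    -- The lower end moves down one exponent at a time, isolating the constant term of D^r.
    have low : ∀ k ≤ 4, ∀ b, 4 * s ≤ b + 4 * r + k → b + 4 ≤ 4 * s + 4 * r →
        quartic * Polynomial.X ^ b ∈ numerators s := by
      intro k
      induction k with
      | zero => intro _ b h1 h2; exact ih (by omega) b h1 h2
      | succ k ihk =>
        intro hk b h1 h2
        by_cases hb : 4 * s ≤ b + 4 * r + k
        · exact ihk (by omega) b hb h2
        · exact mul_X_pow_mem_of_forall_ne (i := 0) hdeg.le (by omega) h0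
            (hpow b (by omega) (by omega)) fun j hj hj0 => ihk (by omega) _ (by omega) (by omega)
    -- The upper end moves up in the same way, isolating the leading term of D^r.
    have high : ∀ k ≤ 4, ∀ b, 4 * s ≤ b + 4 * (r + 1) → b + 4 ≤ 4 * s + 4 * r + k →
        quartic * Polynomial.X ^ b ∈ numerators s := by
      intro k
      induction k with
      | zero => intro _ b h1 h2; exact low 4 le_rfl b (by omega) h2
      | succ k ihk =>
        intro hk b h1 h2
        by_cases hb : b + 4 ≤ 4 * s + 4 * r + k
        · exact ihk (by omega) b h1 hb
        · obtain ⟨a, rfl⟩ : ∃ a, b = a + 4 * r := ⟨b - 4 * r, by omega⟩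
          exact mul_X_pow_mem_of_forall_ne hdeg.le le_rfl htop
            (hpow a (by omega) (by omega)) fun j hj hj0 => ihk (by omega) _ (by omega) (by omega)
    intro b h1 h2
    exact high 4 le_rfl b h1 (by omega)

theorem natDegree_quartic_mul_le_iff {r : Polynomial ℝ} {n : ℕ} :
    (quartic * r).natDegree ≤ n + 4 ↔ r.natDegree ≤ n := by
  rcases eq_or_ne r 0 with rfl | hr
  · simp
  · rw [quartic_monic.natDegree_mul' hr, natDegree_quartic]; omega

theorem numerators_eq_seminormal {s : ℕ} (hs : 1 ≤ s) : numerators s = seminormal s := by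
  refine le_antisymm (numerators_le_seminormal s) ?_
  rintro p ⟨hp, c, r, hr⟩
  have hX : (Polynomial.X ^ (4 * s) : Polynomial ℝ) ∈ numerators s := by
    rw [pow_mul]; exact pow_mem_numerators X_pow_four_mem_numerators s
  have hdeg : (quartic * r).natDegree ≤ 8 * s := by
    rw [← hr]
    refine (Polynomial.natDegree_sub_le _ _).trans (max_le hp ?_)
    exact (Polynomial.natDegree_C_mul_X_pow_le _ _).trans (by omega)
  rw [show 8 * s = (8 * s - 4) + 4 by omega, natDegree_quartic_mul_le_iff] at hdeg
  rw [sub_eq_iff_eq_add.1 hr]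
  refine add_mem ?_ (by rw [← Polynomial.smul_eq_C_mul]; exact Submodule.smul_mem _ _ hX)
  rw [r.as_sum_range_C_mul_X_pow, Finset.mul_sum]
  refine Submodule.sum_mem _ fun j hj => ?_
  rw [mul_left_comm, ← Polynomial.smul_eq_C_mul]
  rw [Finset.mem_range] at hj
  exact Submodule.smul_mem _ _
    (quartic_mul_X_pow_mem_numerators_of_le hs le_rfl j (by omega) (by omega))

theorem isCoprime_quartic_X : IsCoprime quartic Polynomial.X :=
  ⟨1, Polynomial.X - Polynomial.X ^ 3, by unfold quartic; ring⟩

theorem mem_degreeLT_iff_natDegree_quartic_mul_le {s : ℕ} (hs : 1 ≤ s) {r : Polynomial ℝ} :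
    r ∈ Polynomial.degreeLT ℝ (8 * s - 3) ↔ (quartic * r).natDegree ≤ 8 * s := by
  conv_rhs => rw [show 8 * s = (8 * s - 4) + 4 by omega, natDegree_quartic_mul_le_iff]
  rw [Polynomial.mem_degreeLT]
  rcases eq_or_ne r 0 with rfl | hr
  · simp
  · rw [← Polynomial.natDegree_lt_iff_degree_lt hr]; omega

theorem finrank_seminormal {s : ℕ} (hs : 1 ≤ s) : Module.finrank ℝ (seminormal s) = 8 * s - 2 := by
  let φ : ℝ × Polynomial.degreeLT ℝ (8 * s - 3) →ₗ[ℝ] Polynomial ℝ :=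
    (LinearMap.toSpanSingleton ℝ _ (Polynomial.X ^ (4 * s))).coprod
      ((LinearMap.mulLeft ℝ quartic).comp (Submodule.subtype _))
  have hφ : ∀ c r, φ (c, r) = Polynomial.C c * Polynomial.X ^ (4 * s) + quartic * r.1 := fun c r => by
    simp [φ, Polynomial.smul_eq_C_mul]
  have hinj : Function.Injective φ := by
    rw [injective_iff_map_eq_zero]
    rintro ⟨c, r⟩ h
    rw [hφ] at h
    -- The quartic is coprime to z, so it would have to divide the constant c.
    have hc : c = 0 := by
      by_contra hc
      have hdvd : quartic ∣ Polynomial.C c :=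
        (isCoprime_quartic_X.pow_right (n := 4 * s)).dvd_of_dvd_mul_right
          ⟨-r, by linear_combination h⟩
      have := Polynomial.natDegree_le_of_dvd hdvd (Polynomial.C_ne_zero.2 hc)
      rw [natDegree_quartic, Polynomial.natDegree_C] at this
      omega
    rw [hc, map_zero, zero_mul, zero_add, mul_eq_zero, or_iff_right quartic_monic.ne_zero] at h
    rw [hc, Prod.mk_eq_zero]
    exact ⟨rfl, Subtype.ext h⟩
  have hrange : LinearMap.range φ = seminormal s := by
    ext p
    constructor
    · rintro ⟨⟨c, r⟩, rfl⟩
      rw [hφ]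
      refine add_mem ?_ (mem_seminormal_of_quartic_dvd ?_ (dvd_mul_right _ _))
      · rw [← Polynomial.smul_eq_C_mul]
        exact Submodule.smul_mem _ _ (X_pow_mem_seminormal s)
      · exact (mem_degreeLT_iff_natDegree_quartic_mul_le hs).1 r.2
    · rintro ⟨hp, c, r, hr⟩
      refine ⟨(c, ⟨r, ?_⟩), ?_⟩
      · rw [mem_degreeLT_iff_natDegree_quartic_mul_le hs, ← hr]
        refine (Polynomial.natDegree_sub_le _ _).trans (max_le hp ?_)
        exact (Polynomial.natDegree_C_mul_X_pow_le _ _).trans (by omega)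
      · rw [hφ]; linear_combination -hr
  rw [← hrange, LinearMap.finrank_range_of_inj hinj, Module.finrank_prod, Module.finrank_self,
    (Polynomial.degreeLTEquiv ℝ _).finrank_eq, Module.finrank_fin_fun]
  omega

theorem affineHilbertFunction_I {s : ℕ} (hs : 1 ≤ s) :
    affineHilbertFunction I s = 8 * s - 2 := by
  -- Polynomials on the curve and their numerators are compared as functions of z ≠ 0: `L` has
  -- kernel `I` in degree at most s, and its range is the image of the numerators.
  let ι : Polynomial ℝ →ₗ[ℝ] ({z : ℝ // z ≠ 0} → ℝ) :=
    LinearMap.pi fun z => Polynomial.leval z.1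
  have hι : Function.Injective ι := fun p q h =>
    Polynomial.eq_of_infinite_eval_eq p q ((Set.finite_singleton (0 : ℝ)).infinite_compl.mono
      fun z hz => congrFun h ⟨z, hz⟩)
  let L : restrictTotalDegree (Fin 7) ℝ s →ₗ[ℝ] ({z : ℝ // z ≠ 0} → ℝ) :=
    LinearMap.pi fun z => (z.1 ^ (2 * s) * (z.1 ^ 4 - z.1 ^ 2 + 1) ^ s) •
      (aeval (curvePoint z)).toLinearMap ∘ₗ Submodule.subtype _
  have hL : ∀ f z, L f z = z.1 ^ (2 * s) * (z.1 ^ 4 - z.1 ^ 2 + 1) ^ s *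
      aeval (curvePoint z) f.1 := fun f z => rfl
  have hker : LinearMap.ker L =
      (I.restrictScalars ℝ).submoduleOf (restrictTotalDegree (Fin 7) ℝ s) := by
    ext f
    rw [LinearMap.mem_ker, Submodule.submoduleOf, Submodule.mem_comap]
    change _ ↔ f.1 ∈ I
    constructor
    · intro h
      refine mem_of_vanishes_on_infinite (S := {0}ᶜ) (Set.finite_singleton 0).infinite_compl
        (fun z hz => hz) fun z hz => ?_
      have h1 := congrFun h ⟨z, hz⟩
      rw [hL, Pi.zero_apply] at h1
      exact (mul_eq_zero.1 h1).resolve_left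
        (mul_ne_zero (pow_ne_zero _ hz) (pow_ne_zero _ (quartic_pos z).ne'))
    · intro h
      ext z
      rw [hL, curvePoint_mem_zeroLocus z.2 _ h, mul_zero, Pi.zero_apply]
  have hrange : LinearMap.range L = (seminormal s).map ι := by
    rw [← numerators_eq_seminormal hs]
    ext g
    constructor
    · rintro ⟨f, rfl⟩
      have hf := (mem_restrictTotalDegree _ _ _).1 f.2
      obtain ⟨p, -, hp⟩ := exists_seminormal hf
      exact ⟨p, ⟨f.1, hf, hp⟩, funext fun z => hp z.1 z.2⟩
    · rintro ⟨p, ⟨f, hf, hp⟩, rfl⟩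
      exact ⟨⟨f, (mem_restrictTotalDegree _ _ _).2 hf⟩, funext fun z => (hp z.1 z.2).symm⟩
  rw [affineHilbertFunction, ← hker, L.quotKerEquivRange.finrank_eq, hrange,
    ← (Submodule.equivMapOfInjective ι hι _).finrank_eq, finrank_seminormal hs]

theorem hasDimension_zeroLocus_I : HasDimension (zeroLocus ℝ I) 1 := by
  refine ⟨Polynomial.C 8 * Polynomial.X + Polynomial.C (-2), ?_,
    Polynomial.degree_linear (by norm_num)⟩
  rw [vanishingIdeal_zeroLocus_I]
  filter_upwards [Filter.eventually_ge_atTop 1] with s hs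
  rw [affineHilbertFunction_I hs, Nat.cast_sub (by omega)]
  simp; ring

/-! ### Plane geometry -/

theorem dist_sq_eq_coordinates (p q : Plane) :
    dist p q ^ 2 = (p 0 - q 0) ^ 2 + (p 1 - q 1) ^ 2 := by
  rw [EuclideanSpace.dist_sq_eq, Fin.sum_univ_two, Real.dist_eq, Real.dist_eq, sq_abs, sq_abs]

theorem plane_ext {p q : Plane} (h0 : p 0 = q 0) (h1 : p 1 = q 1) : p = q := by
  ext i; fin_cases i <;> assumption

theorem dist_sq_pos {p q : Plane} (h : p ≠ q) : 0 < dist p q ^ 2 := pow_pos (dist_pos.2 h) 2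

/-- The rotation of a vector by a right angle. -/
def quarterTurn (v : Plane) : Plane := !₂[-v 1, v 0]

@[simp] theorem quarterTurn_zero (v : Plane) : quarterTurn v 0 = -v 1 := rfl
@[simp] theorem quarterTurn_one (v : Plane) : quarterTurn v 1 = v 0 := rfl

theorem quarterTurn_ne_zero {v : Plane} (hv : v ≠ 0) : quarterTurn v ≠ 0 := fun h => hv <| by
  have h0 := congrArg (fun w : Plane => w 0) h
  have h1 := congrArg (fun w : Plane => w 1) h
  exact plane_ext (by simpa using h1) (by simpa using h0)

/-- A vector orthogonal to `v` is a multiple of the quarter turn of `v`. -/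
theorem exists_eq_smul_quarterTurn {u v : Plane} (hv : v ≠ 0) (h : u 0 * v 0 + u 1 * v 1 = 0) :
    ∃ τ : ℝ, u = τ • quarterTurn v := by
  have hn : v 0 ^ 2 + v 1 ^ 2 ≠ 0 := fun h0 => hv <| plane_ext
    (by simpa using (by nlinarith [sq_nonneg (v 0), sq_nonneg (v 1)] : v 0 ^ 2 = 0))
    (by simpa using (by nlinarith [sq_nonneg (v 0), sq_nonneg (v 1)] : v 1 ^ 2 = 0))
  refine ⟨(u 1 * v 0 - u 0 * v 1) / (v 0 ^ 2 + v 1 ^ 2), plane_ext ?_ ?_⟩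
  · simp only [PiLp.smul_apply, quarterTurn_zero, smul_eq_mul]
    field_simp
    linear_combination v 0 * h
  · simp only [PiLp.smul_apply, quarterTurn_one, smul_eq_mul]
    field_simp
    linear_combination v 1 * h

theorem reflection_quarterTurn (p v : Plane) (τ t : ℝ) :
    EuclideanGeometry.reflection (affineSpan ℝ {p, p + quarterTurn v})
      (p + τ • quarterTurn v + t • v) = p + τ • quarterTurn v - t • v := by
  have hmem : p + τ • quarterTurn v ∈ affineSpan ℝ {p, p + quarterTurn v} := by
    have := AffineMap.lineMap_mem_affineSpan_pair τ p (p + quarterTurn v)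
    rwa [AffineMap.lineMap_apply, vsub_eq_sub, add_sub_cancel_left, vadd_eq_add,
      add_comm (τ • _)] at this
  have horth : t • v ∈ (affineSpan ℝ {p, p + quarterTurn v}).directionᗮ := by
    rw [direction_affineSpan, Submodule.mem_orthogonal]
    intro u hu
    obtain ⟨r, rfl⟩ := mem_vectorSpan_pair_rev.1 hu
    simp [PiLp.inner_apply]
    ring
  have := EuclideanGeometry.reflection_orthogonal_vadd hmem horth
  rw [vadd_eq_add, vadd_eq_add] at this
  rw [add_comm _ (t • v), this]
  abel

/-- A configuration that is mapped into itself by the reflection in the line through `p` orthogonal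
to `v` has a line of symmetry. -/
theorem hasLineOfSymmetry_of_forall {n : ℕ} {x : Fin n → Plane} {p v : Plane} (hv : v ≠ 0)
    (h : ∀ i, ∃ j, ∃ τ t : ℝ, x i = p + τ • quarterTurn v + t • v ∧
      x j = p + τ • quarterTurn v - t • v) : HasLineOfSymmetry x := by
  refine ⟨p, p + quarterTurn v, by simpa using quarterTurn_ne_zero hv, ?_⟩
  have hsub : ∀ i, ∃ j, EuclideanGeometry.reflection (affineSpan ℝ {p, p + quarterTurn v}) (x i)
      = x j := fun i => by
    obtain ⟨j, τ, t, hi, hj⟩ := h i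
    exact ⟨j, by rw [hi, hj, reflection_quarterTurn]⟩
  apply Set.Subset.antisymm
  · rintro _ ⟨_, ⟨i, rfl⟩, rfl⟩
    obtain ⟨j, hj⟩ := hsub i
    exact ⟨j, hj.symm⟩
  · rintro _ ⟨i, rfl⟩
    obtain ⟨j, hj⟩ := hsub i
    exact ⟨x j, ⟨j, rfl⟩, by rw [← hj, EuclideanGeometry.reflection_reflection]⟩

/-- A kite is symmetric. -/
theorem hasLineOfSymmetry_of_kite {x : Fin 4 → Plane} {i j k l : Fin 4}
    (hcover : ∀ a, a = i ∨ a = j ∨ a = k ∨ a = l) (hij : x i ≠ x j)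
    (hk : dist (x i) (x k) ^ 2 = dist (x j) (x k) ^ 2)
    (hl : dist (x i) (x l) ^ 2 = dist (x j) (x l) ^ 2) : HasLineOfSymmetry x := by
  set p : Plane := (1 / 2 : ℝ) • (x i + x j) with hp
  set v : Plane := (1 / 2 : ℝ) • (x i - x j) with hv
  have hv0 : v ≠ 0 := by
    rw [hv, smul_ne_zero_iff, sub_ne_zero]; exact ⟨by norm_num, hij⟩
  have hi : x i = p + v := by rw [hp, hv]; module
  have hj : x j = p - v := by rw [hp, hv]; module
  have key : ∀ k, dist (x i) (x k) ^ 2 = dist (x j) (x k) ^ 2 →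
      ∃ τ t : ℝ, x k = p + τ • quarterTurn v + t • v ∧ x k = p + τ • quarterTurn v - t • v := by
    intro k hk
    rw [dist_sq_eq_coordinates, dist_sq_eq_coordinates] at hk
    obtain ⟨τ, hτ⟩ := exists_eq_smul_quarterTurn (u := x k - p) hv0 (by
      simp only [hp, hv, PiLp.sub_apply, PiLp.smul_apply, PiLp.add_apply, smul_eq_mul]
      linear_combination - hk / 4)
    exact ⟨τ, 0, by rw [← hτ]; simp, by rw [← hτ]; simp⟩
  refine hasLineOfSymmetry_of_forall (p := p) hv0 fun a => ?_
  rcases hcover a with rfl | rfl | rfl | rfl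
  · exact ⟨j, 0, 1, by rw [hi]; module, by rw [hj]; module⟩
  · exact ⟨i, 0, -1, by rw [hj]; module, by rw [hi]; module⟩
  · exact ⟨_, key _ hk⟩
  · exact ⟨_, key _ hl⟩

/-- An isosceles trapezoid is symmetric. -/
theorem hasLineOfSymmetry_of_trapezoid {x : Fin 4 → Plane} {t : ℝ} (h01 : x 0 ≠ x 1)
    (hpar : x 2 - x 3 = t • (x 0 - x 1))
    (h1 : dist (x 0) (x 2) ^ 2 = dist (x 1) (x 3) ^ 2)
    (h2 : dist (x 0) (x 3) ^ 2 = dist (x 1) (x 2) ^ 2) : HasLineOfSymmetry x := by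
  set p : Plane := (1 / 2 : ℝ) • (x 0 + x 1) with hp
  set v : Plane := (1 / 2 : ℝ) • (x 0 - x 1) with hv
  have hv0 : v ≠ 0 := by
    rw [hv, smul_ne_zero_iff, sub_ne_zero]; exact ⟨by norm_num, h01⟩
  have hx0 : x 0 = p + v := by rw [hp, hv]; module
  have hx1 : x 1 = p - v := by rw [hp, hv]; module
  have hx23 : x 2 - x 3 = (2 * t) • v := by rw [hpar, hv]; module
  rw [dist_sq_eq_coordinates, dist_sq_eq_coordinates] at h1 h2
  -- The sum of the two distance equations puts the midpoint of `x 2` and `x 3` on the perpendicular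
  -- bisector of `x 0` and `x 1`.
  obtain ⟨τ, hτ⟩ := exists_eq_smul_quarterTurn (u := (1 / 2 : ℝ) • (x 2 + x 3) - p) hv0 (by
    simp only [hp, hv, PiLp.sub_apply, PiLp.smul_apply, PiLp.add_apply, smul_eq_mul]
    linear_combination - (h1 + h2) / 8)
  have hx2 : x 2 = p + τ • quarterTurn v + t • v := by
    rw [← hτ]
    have : t • v = (1 / 2 : ℝ) • ((2 * t) • v) := by module
    rw [this, ← hx23]; module
  have hx3 : x 3 = p + τ • quarterTurn v - t • v := by
    rw [← hτ]
    have : t • v = (1 / 2 : ℝ) • ((2 * t) • v) := by module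
    rw [this, ← hx23]; module
  refine hasLineOfSymmetry_of_forall (p := p) hv0 fun a => ?_
  fin_cases a
  · exact ⟨1, 0, 1, hx0.trans (by module), hx1.trans (by module)⟩
  · exact ⟨0, 0, -1, hx1.trans (by module), hx0.trans (by module)⟩
  · exact ⟨3, τ, t, hx2, hx3⟩
  · exact ⟨2, τ, -t, hx3.trans (by module), hx2.trans (by module)⟩

/-- A line of symmetry of a planar configuration induces a nontrivial involution of the indices
that preserves the mutual distances. -/
theorem exists_involution_of_hasLineOfSymmetry {n : ℕ} {x : Fin n → Plane}
    (hx : Function.Injective x) (hcol : ¬ Collinear ℝ (Set.range x)) (h : HasLineOfSymmetry x) :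
    ∃ π : Fin n → Fin n, (∀ i, π (π i) = i) ∧ π ≠ id ∧
      ∀ i j, dist (x (π i)) (x (π j)) = dist (x i) (x j) := by
  obtain ⟨p, q, hpq, himg⟩ := h
  set r := EuclideanGeometry.reflection (affineSpan ℝ {p, q}) with hr
  have hex : ∀ i, ∃ j, x j = r (x i) := fun i => by
    have : r (x i) ∈ Set.range x := by rw [← himg]; exact ⟨x i, ⟨i, rfl⟩, rfl⟩
    exact this
  choose π hπ using hex
  refine ⟨π, fun i => hx ?_, fun hid => hcol ?_, fun i j => ?_⟩
  · rw [hπ, hπ, hr, EuclideanGeometry.reflection_reflection]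
  -- A reflection that fixes all the points has all of them on its axis.
  · rw [collinear_iff_exists_forall_eq_smul_vadd]
    refine ⟨p, q - p, ?_⟩
    rintro _ ⟨i, rfl⟩
    have hi : x i ∈ affineSpan ℝ {p, q} := by
      rw [← EuclideanGeometry.reflection_eq_self_iff, ← hr, ← hπ, hid, id]
    obtain ⟨t, ht⟩ := mem_affineSpan_pair_iff_exists_lineMap_eq.1 hi
    exact ⟨t, ht.symm⟩
  · rw [hπ, hπ, r.dist_map]

set_option maxRecDepth 10000 in
/-- The involutions of four indices. -/
theorem involution_four (π : Fin 4 → Fin 4) (hπ : ∀ i, π (π i) = i) (hid : π ≠ id) :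
    π = ![1, 0, 2, 3] ∨ π = ![0, 1, 3, 2] ∨ π = ![2, 1, 0, 3] ∨ π = ![3, 1, 2, 0] ∨
      π = ![0, 2, 1, 3] ∨ π = ![0, 3, 2, 1] ∨ π = ![1, 0, 3, 2] ∨ π = ![2, 3, 0, 1] ∨
      π = ![3, 2, 1, 0] := by
  revert π; decide

/-! ### Normalized relative equilibria -/

/-- Relative equilibria whose angular velocity is the total circulation, without the center. -/
theorem isRelativeEquilibrium_sum_iff {n : ℕ} {Γ : Fin n → ℝ} (hΓ : ∑ i, Γ i ≠ 0)
    {x : Fin n → Plane} : IsRelativeEquilibrium Γ (∑ i, Γ i) x ↔ Function.Injective x ∧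
      ∀ i, ∑ j, (Γ j * (1 / dist (x i) (x j) ^ 2 - 1)) • (x j - x i) = 0 := by
  set F : Fin n → Plane := fun i => ∑ j, (Γ j / dist (x i) (x j) ^ 2) • (x j - x i) with hF
  have hFe : ∀ i, ∑ j ∈ Finset.univ.erase i, (Γ j / dist (x i) (x j) ^ 2) • (x j - x i) = F i :=
    fun i => Finset.sum_erase _ (by simp)
  have hsplit : ∀ i, ∑ j, (Γ j * (1 / dist (x i) (x j) ^ 2 - 1)) • (x j - x i) =
      F i - (∑ j, Γ j • x j - (∑ j, Γ j) • x i) := fun i => by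
    rw [hF, Finset.sum_smul, ← Finset.sum_sub_distrib, ← Finset.sum_sub_distrib]
    refine Finset.sum_congr rfl fun j _ => ?_
    rw [mul_sub, mul_one_div, sub_smul, mul_one, smul_sub (Γ j)]
  -- The pair interactions are antisymmetric, as in Newton's third law; this forces the center of
  -- rotation to be the center of vorticity.
  have hanti : ∑ i, Γ i • F i = 0 := by
    have h : ∑ i, Γ i • F i = - ∑ i, Γ i • F i := by
      simp only [hF, Finset.smul_sum]
      conv_rhs => rw [Finset.sum_comm, ← Finset.sum_neg_distrib]
      refine Finset.sum_congr rfl fun i _ => ?_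
      rw [← Finset.sum_neg_distrib]
      refine Finset.sum_congr rfl fun j _ => ?_
      rw [dist_comm (x j) (x i), smul_smul, smul_smul, ← smul_neg, neg_sub]
      congr 1
      ring
    have h2 : (2 : ℝ) • ∑ i, Γ i • F i = 0 := by
      rw [two_smul]; nth_rw 1 [h]; exact neg_add_cancel _
    exact (smul_eq_zero.1 h2).resolve_left two_ne_zero
  constructor
  · rintro ⟨-, hinj, c, hc⟩
    refine ⟨hinj, fun i => ?_⟩
    simp only [hFe] at hc
    have hcen : ∑ j, Γ j • x j = (∑ j, Γ j) • c := by
      have h : (-∑ j, Γ j) • (∑ j, Γ j • x j - (∑ j, Γ j) • c) = 0 := by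
        rw [← hanti, Finset.sum_smul, ← Finset.sum_sub_distrib, Finset.smul_sum]
        refine Finset.sum_congr rfl fun j _ => ?_
        rw [← hc, ← smul_sub, smul_comm]
      exact sub_eq_zero.1 ((smul_eq_zero.1 h).resolve_left (neg_ne_zero.2 hΓ))
    rw [hsplit, hcen, ← hc, neg_smul, smul_sub]
    abel
  · rintro ⟨hinj, h⟩
    refine ⟨hΓ, hinj, (∑ j, Γ j)⁻¹ • ∑ j, Γ j • x j, fun i => ?_⟩
    rw [hFe, smul_sub, neg_smul _ (_ • _), smul_inv_smul₀ hΓ, neg_smul]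
    have := h i
    rw [hsplit, sub_eq_zero] at this
    rw [this]; abel

theorem sum_strengths (m : ℝ) : ∑ i, strengths m i = 2 + 2 * m := by
  simp [Fin.sum_univ_four, strengths]; ring

/-! ### The configurations on the curve -/

/-- A plane point in coordinates adapted to the Eisenstein lattice. -/
def eisensteinPoint (a b : ℝ) : Plane := !₂[√(1 / 2) * a, √(1 / 2) * (√3 * b)]

theorem dist_eisensteinPoint (a b c d : ℝ) :
    dist (eisensteinPoint a b) (eisensteinPoint c d) ^ 2 = ((a - c) ^ 2 + 3 * (b - d) ^ 2) / 2 := by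
  rw [dist_sq_eq_coordinates]
  have h2 : √(1 / 2 : ℝ) ^ 2 = 1 / 2 := Real.sq_sqrt (by norm_num)
  have h3 : √(3 : ℝ) ^ 2 = 3 := Real.sq_sqrt (by norm_num)
  simp only [eisensteinPoint, PiLp.toLp_apply, Matrix.cons_val_zero, Matrix.cons_val_one]
  linear_combination ((a - c) ^ 2 + √3 ^ 2 * (b - d) ^ 2) * h2 + (b - d) ^ 2 / 2 * h3

/-- The configuration with mutual distances `curvePoint z`. -/
def curveConfiguration (z : ℝ) : Fin 4 → Plane :=
  -- With ω = exp(2πi/3), and up to the scale √(1/2), the positions are 0, z + ω²/z, ω + ω²/z and z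
  -- + ω.
  ![eisensteinPoint 0 0, eisensteinPoint (z - 1 / (2 * z)) (-(1 / (2 * z))),
    eisensteinPoint (-(1 / 2) - 1 / (2 * z)) (1 / 2 - 1 / (2 * z)),
    eisensteinPoint (z - 1 / 2) (1 / 2)]

theorem coordinates_curveConfiguration {z : ℝ} (hz : z ≠ 0) :
    coordinates (curveConfiguration z) (2 * z ^ 2 / (z ^ 4 - z ^ 2 + 1) - 1) = curvePoint z := by
  ext i
  fin_cases i <;>
    simp only [coordinates, curveConfiguration, curvePoint, Matrix.cons_val, Fin.zero_eta,
      Fin.mk_one, Fin.reduceFinMk, dist_eisensteinPoint] <;> field_simp <;> ring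

theorem curveConfiguration_relations {z : ℝ} (hz : z ≠ 0) :
    dist (curveConfiguration z 0) (curveConfiguration z 1) ^ 2 =
        (z ^ 4 - z ^ 2 + 1) / (2 * z ^ 2) ∧
      dist (curveConfiguration z 0) (curveConfiguration z 2) ^ 2 = (z ^ 2 - z + 1) / (2 * z ^ 2) ∧
      dist (curveConfiguration z 0) (curveConfiguration z 3) ^ 2 = (z ^ 2 - z + 1) / 2 ∧
      dist (curveConfiguration z 1) (curveConfiguration z 2) ^ 2 = (z ^ 2 + z + 1) / 2 ∧
      dist (curveConfiguration z 1) (curveConfiguration z 3) ^ 2 = (z ^ 2 + z + 1) / (2 * z ^ 2) ∧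
      dist (curveConfiguration z 2) (curveConfiguration z 3) ^ 2 =
        (z ^ 4 + z ^ 2 + 1) / (2 * z ^ 2) := by
  have h := coordinates_curveConfiguration hz
  exact ⟨congrFun h 0, congrFun h 1, congrFun h 2, congrFun h 3, congrFun h 4, congrFun h 5⟩

theorem quadratic_pos (z : ℝ) : 0 < z ^ 2 + z + 1 := by nlinarith [sq_nonneg (z + 1 / 2)]

theorem quadratic_pos' (z : ℝ) : 0 < z ^ 2 - z + 1 := by nlinarith [sq_nonneg (z - 1 / 2)]

theorem injective_curveConfiguration {z : ℝ} (hz : z ≠ 0) :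
    Function.Injective (curveConfiguration z) := by
  obtain ⟨h01, h02, h03, h12, h13, h23⟩ := curveConfiguration_relations hz
  have hz2 : 0 < 2 * z ^ 2 := by positivity
  have hne : ∀ {p q : Plane} {s : ℝ}, dist p q ^ 2 = s → 0 < s → p ≠ q := by
    rintro p q s h hs rfl
    rw [dist_self] at h
    norm_num at h
    exact hs.ne h
  have e01 := hne h01 (div_pos (quartic_pos z) hz2)
  have e02 := hne h02 (div_pos (quadratic_pos' z) hz2)
  have e03 := hne h03 (half_pos (quadratic_pos' z))
  have e12 := hne h12 (half_pos (quadratic_pos z))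
  have e13 := hne h13 (div_pos (quadratic_pos z) hz2)
  have e23 := hne h23 (by positivity)
  intro i j h
  fin_cases i <;> fin_cases j <;> first | rfl | (exfalso; first
    | exact e01 h | exact e02 h | exact e03 h | exact e12 h | exact e13 h | exact e23 h
    | exact e01 h.symm | exact e02 h.symm | exact e03 h.symm | exact e12 h.symm
    | exact e13 h.symm | exact e23 h.symm)

theorem isRelativeEquilibrium_curveConfiguration {z m : ℝ} (hz : z ≠ 0)
    (hm : m = 2 * z ^ 2 / (z ^ 4 - z ^ 2 + 1) - 1) :
    IsRelativeEquilibrium (strengths m) (∑ i, strengths m i) (curveConfiguration z) := by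
  have hD := quartic_pos z
  have hp := quadratic_pos z
  have hq := quadratic_pos' z
  have hpq : z ^ 4 + z ^ 2 + 1 = (z ^ 2 + z + 1) * (z ^ 2 - z + 1) := by ring
  have hm1 : 0 < m + 1 := by rw [hm, sub_add_cancel]; positivity
  rw [isRelativeEquilibrium_sum_iff (by rw [sum_strengths]; linarith)]
  refine ⟨injective_curveConfiguration hz, ?_⟩
  obtain ⟨h01, h02, h03, h12, h13, h23⟩ := curveConfiguration_relations hz
  have hz2 : (2 * z ^ 2) ≠ 0 := by positivity
  -- In this form the denominator D of m never enters the equations: m is a common factor at the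
  -- first two vortices, and in `S23` its denominator cancels.
  have S01 : 1 / dist (curveConfiguration z 0) (curveConfiguration z 1) ^ 2 - 1 = m := by
    rw [h01, one_div_div, hm]
  have S02 : 1 / dist (curveConfiguration z 0) (curveConfiguration z 2) ^ 2 - 1 =
      (z ^ 2 + z - 1) / (z ^ 2 - z + 1) := by
    rw [h02, one_div_div, div_sub_one hq.ne']; ring
  have S03 : 1 / dist (curveConfiguration z 0) (curveConfiguration z 3) ^ 2 - 1 =
      (1 + z - z ^ 2) / (z ^ 2 - z + 1) := by
    rw [h03, one_div_div, div_sub_one hq.ne']; ring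
  have S12 : 1 / dist (curveConfiguration z 1) (curveConfiguration z 2) ^ 2 - 1 =
      (1 - z - z ^ 2) / (z ^ 2 + z + 1) := by
    rw [h12, one_div_div, div_sub_one hp.ne']; ring
  have S13 : 1 / dist (curveConfiguration z 1) (curveConfiguration z 3) ^ 2 - 1 =
      (z ^ 2 - z - 1) / (z ^ 2 + z + 1) := by
    rw [h13, one_div_div, div_sub_one hp.ne']; ring
  have S23 : m * (1 / dist (curveConfiguration z 2) (curveConfiguration z 3) ^ 2 - 1) =
      (z ^ 4 - 3 * z ^ 2 + 1) / ((z ^ 2 + z + 1) * (z ^ 2 - z + 1)) := by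
    rw [h23, one_div_div, ← hpq, div_sub_one (by positivity), hm, div_sub_one hD.ne',
      div_mul_div_comm, div_eq_div_iff (by positivity) (by positivity)]
    ring
  have hp' : z * (z + 1) + 1 ≠ 0 := fun h => hp.ne' (by linear_combination h)
  have hq' : z * (z - 1) + 1 ≠ 0 := fun h => hq.ne' (by linear_combination h)
  intro i
  fin_cases i
  all_goals
    simp only [Fin.sum_univ_four, Fin.zero_eta, Fin.mk_one, Fin.reduceFinMk, sub_self, smul_zero]
    simp only [dist_comm (curveConfiguration z 1) (curveConfiguration z 0),
      dist_comm (curveConfiguration z 2) (curveConfiguration z 0),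
      dist_comm (curveConfiguration z 3) (curveConfiguration z 0),
      dist_comm (curveConfiguration z 2) (curveConfiguration z 1),
      dist_comm (curveConfiguration z 3) (curveConfiguration z 1),
      dist_comm (curveConfiguration z 3) (curveConfiguration z 2), strengths, Matrix.cons_val,
      S01, S02, S03, S12, S13, S23]
    apply plane_ext <;>
      simp [curveConfiguration, eisensteinPoint] <;> field_simp <;> ring

theorem not_collinear_curveConfiguration {z : ℝ} (hz : z ≠ 0) :
    ¬ Collinear ℝ (Set.range (curveConfiguration z)) := by
  intro h
  rw [collinear_iff_of_mem (p₀ := curveConfiguration z 0) (Set.mem_range_self 0)] at h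
  obtain ⟨v, hv⟩ := h
  have cross : ∀ i j, curveConfiguration z i 0 * curveConfiguration z j 1 =
      curveConfiguration z j 0 * curveConfiguration z i 1 := fun i j => by
    obtain ⟨r, hr⟩ := hv _ ⟨i, rfl⟩
    obtain ⟨t, ht⟩ := hv _ ⟨j, rfl⟩
    rw [hr, ht]
    simp [curveConfiguration, eisensteinPoint]
    ring
  have h2 : √(1 / 2 : ℝ) ≠ 0 := (Real.sqrt_pos.2 (by norm_num)).ne'
  have h3 : √(3 : ℝ) ≠ 0 := (Real.sqrt_pos.2 (by norm_num)).ne'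
  have key : ∀ {a b c d : ℝ}, eisensteinPoint a b 0 * eisensteinPoint c d 1 =
      eisensteinPoint c d 0 * eisensteinPoint a b 1 → a * d = c * b := fun {a b c d} h => by
    simp only [eisensteinPoint, PiLp.toLp_apply, Matrix.cons_val_zero, Matrix.cons_val_one] at h
    have : √(1 / 2 : ℝ) ^ 2 * √3 * (a * d - c * b) = 0 := by linear_combination h
    exact sub_eq_zero.1 ((mul_eq_zero.1 this).resolve_left (by positivity))
  have e1 := key (cross 1 2)
  have e2 := key (cross 1 3)
  field_simp at e1 e2
  have : z * z = 0 := by linear_combination z / 4 * e2 - e1 / 4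
  simp [hz] at this

/-- Each of the nine involutions equates two different distances, which forces z = 0 or z = ±1. -/
theorem not_hasLineOfSymmetry_curveConfiguration {z : ℝ} (hz : z ≠ 0) (h1 : z ≠ 1)
    (h2 : z ≠ -1) : ¬ HasLineOfSymmetry (curveConfiguration z) := by
  intro h
  obtain ⟨π, hπ, hid, hdist⟩ := exists_involution_of_hasLineOfSymmetry
    (injective_curveConfiguration hz) (not_collinear_curveConfiguration hz) h
  obtain ⟨h01, h02, h03, h12, h13, h23⟩ := curveConfiguration_relations hz
  have hz2 : (2 * z ^ 2) ≠ 0 := by positivity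
  have hp := quadratic_pos z
  have hq := quadratic_pos' z
  have s : ∀ i j, dist (curveConfiguration z (π i)) (curveConfiguration z (π j)) ^ 2 =
      dist (curveConfiguration z i) (curveConfiguration z j) ^ 2 := fun i j => by rw [hdist]
  have s01 := s 0 1
  have s02 := s 0 2
  have s03 := s 0 3
  have s23 := s 2 3
  have fin : ∀ {r : ℝ}, 0 < r → r * (z - 1) = 0 ∨ r * (z + 1) = 0 → False := by
    rintro r hr (h | h)
    · exact h1 (sub_eq_zero.1 ((mul_eq_zero.1 h).resolve_left hr.ne'))
    · exact h2 (eq_neg_of_add_eq_zero_left ((mul_eq_zero.1 h).resolve_left hr.ne'))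
  rcases involution_four π hπ hid with rfl | rfl | rfl | rfl | rfl | rfl | rfl | rfl | rfl <;>
    simp only [Matrix.cons_val, dist_comm (curveConfiguration z 1) (curveConfiguration z 0),
      dist_comm (curveConfiguration z 2) (curveConfiguration z 0),
      dist_comm (curveConfiguration z 3) (curveConfiguration z 0),
      dist_comm (curveConfiguration z 2) (curveConfiguration z 1),
      dist_comm (curveConfiguration z 3) (curveConfiguration z 1),
      dist_comm (curveConfiguration z 3) (curveConfiguration z 2),
      h01, h02, h03, h12, h13, h23] at s01 s02 s03 s23
  · field_simp at s02 s03
    have : z * (z ^ 2 + 1) = 0 := by linear_combination (s02 + s03) / 2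
    exact mul_ne_zero hz (by positivity) this
  · field_simp at s02
    have : (z ^ 2 - z + 1) * (z - 1) * (z + 1) = 0 := by linear_combination s02
    rcases mul_eq_zero.1 this with h | h
    · exact fin hq (Or.inl h)
    · exact h2 (eq_neg_of_add_eq_zero_left h)
  · field_simp at s23
    exact fin hq (Or.inr (by linear_combination -s23))
  · field_simp at s23
    have : z * ((z ^ 2 - z + 1) * (z + 1)) = 0 := by linear_combination -s23
    exact fin hq (Or.inr ((mul_eq_zero.1 this).resolve_left hz))
  · field_simp at s23
    have : z * ((z ^ 2 + z + 1) * (z - 1)) = 0 := by linear_combination -s23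
    exact fin hp (Or.inl ((mul_eq_zero.1 this).resolve_left hz))
  · field_simp at s23
    exact fin hp (Or.inl (by linear_combination s23))
  · field_simp at s02
    exact hz (by linear_combination s02 / 2)
  · field_simp at s01
    exact mul_ne_zero hz hz (by linear_combination s01 / 2)
  · field_simp at s01
    exact mul_ne_zero hz hz (by linear_combination s01 / 2)

theorem curvePoint_one : curvePoint 1 = ![1/2, 1/2, 1/2, 3/2, 3/2, 3/2, 1] := by
  simp only [curvePoint]; norm_num

theorem curvePoint_neg_one : curvePoint (-1) = ![1/2, 3/2, 3/2, 1/2, 1/2, 3/2, 1] := by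
  simp only [curvePoint]; norm_num

theorem curvePoint_mem_asymmetricConfigurations {z : ℝ} (hz : z ≠ 0) (h1 : z ≠ 1) (h2 : z ≠ -1) :
    curvePoint z ∈ asymmetricConfigurations := by
  have hD := quartic_pos z
  refine ⟨2 * z ^ 2 / (z ^ 4 - z ^ 2 + 1) - 1, curveConfiguration z, ?_, ?_,
    isRelativeEquilibrium_curveConfiguration hz rfl, not_collinear_curveConfiguration hz,
    not_hasLineOfSymmetry_curveConfiguration hz h1 h2, (coordinates_curveConfiguration hz).symm⟩
  · have : 0 < 2 * z ^ 2 / (z ^ 4 - z ^ 2 + 1) := by positivity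
    linarith
  · rw [sub_le_iff_le_add, div_le_iff₀ hD]
    nlinarith [sq_nonneg (z ^ 2 - 1)]

/-! ### Algebra of the asymmetric relative equilibria -/

/-- The common target of the cases m ≠ 0 and m = 0: relations among the distances in the form in
which the geometry yields them. -/
theorem mem_zeroLocus_of_relations {p : Fin 7 → ℝ}
    (hbc : p 1 * p 3 = p 5 / 2) (had : p 2 * p 4 = p 5 / 2) (hab : p 1 * p 2 = p 1 + p 2 - p 5 / 2)
    (hcd : p 3 * p 4 = p 3 + p 4 - p 5 / 2) (h1 : p 1 + p 2 + p 3 + p 4 = 2 * p 5 + 1)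
    (h2 : p 0 = p 5 - 1) (h3 : p 5 * (p 6 + 1) = p 6 + 2) : p ∈ zeroLocus ℝ I := by
  intro f hf
  refine aeval_eq_zero_of_mem ?_ ?_ ?_ ?_ ?_ ?_ ?_ ?_ ?_ hf
  · linear_combination h1
  · linear_combination h2
  · linear_combination h3
  · linear_combination (2 * p 4 - p 5) * h1 - 2 * hcd + 2 * p 4 * hab - 2 * p 1 * had
  · linear_combination 2 * hcd
  · linear_combination 2 * had
  · linear_combination 2 * p 3 * h1 - 2 * hcd + 2 * p 3 * hab - 2 * p 2 * hbc
  · linear_combination -2 * p 3 * hab + 2 * (p 2 - 1) * hbc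
  · linear_combination
      2 * (p 2 - 1) * h1 + 2 * (p 3 - 1) * hab - 2 * had + 2 * (1 - p 2) * hbc

/-- The polynomial consequences of the equations for the mutual distances `s`, when `y` is the
affine dependency of the four positions. -/
theorem dziobek_relations {y1 y2 y3 y4 α m β s12 s13 s14 s23 s24 s34 : ℝ}
    (h12 : s12 * (1 + α * m * y1 * y2) = 1) (h13 : s13 * (1 + α * y1 * y3) = 1)
    (h14 : s14 * (1 + α * y1 * y4) = 1) (h23 : s23 * (1 + α * y2 * y3) = 1)
    (h24 : s24 * (1 + α * y2 * y4) = 1) (h34 : s34 * (1 + α * β * y3 * y4) = 1)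
    (hsum : y1 + y2 + y3 + y4 = 0)
    (hT12 : y2 * s12 + y3 * s13 + y4 * s14 = y1 * s12 + y3 * s23 + y4 * s24)
    (hT34 : y1 * s13 + y2 * s23 + y4 * s34 = y1 * s14 + y2 * s24 + y3 * s34)
    (hT : y1 * y2 * s12 + y1 * y3 * s13 + y1 * y4 * s14 + y2 * y3 * s23 + y2 * y4 * s24 +
      y3 * y4 * s34 = 0)
    (hy12 : y1 ≠ y2) (hy34 : y3 ≠ y4) (hσ : y1 + y2 ≠ 0) :
    ∃ w P Q D : ℝ, w = α * (y1 + y2) ^ 2 ∧ P = α * y1 * y2 ∧ Q = α * y3 * y4 ∧ D ≠ 0 ∧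
      D = (1 - P * Q) ^ 2 - w * (1 - P) * (1 - Q) ∧
      D * s12 + (w * (1 - Q) - 2 * Q * (1 - P * Q)) = 0 ∧
      D * s34 + (w * (1 - P) - 2 * P * (1 - P * Q)) = 0 ∧ (1 - P) * (1 - Q) = 0 := by
  set A13 := 1 + α * y1 * y3 with hA13
  set A14 := 1 + α * y1 * y4 with hA14
  set A23 := 1 + α * y2 * y3 with hA23
  set A24 := 1 + α * y2 * y4 with hA24
  -- The difference s13 - s23 equals α y3 (y2 - y1) s13 s23, and likewise for index 4, so y2 - y1
  -- factors out.
  have hE1 : s12 + α * (y3 ^ 2 * (s13 * s23) + y4 ^ 2 * (s14 * s24)) = 0 := by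
    have : (y2 - y1) * (s12 + α * (y3 ^ 2 * (s13 * s23) + y4 ^ 2 * (s14 * s24))) = 0 := by
      linear_combination hT12 + y3 * s13 * h23 - y3 * s23 * h13 + y4 * s14 * h24 - y4 * s24 * h14
    exact (mul_eq_zero.1 this).resolve_left (sub_ne_zero.2 hy12.symm)
  have hE2 : s34 + α * (y1 ^ 2 * (s13 * s14) + y2 ^ 2 * (s23 * s24)) = 0 := by
    have : (y4 - y3) * (s34 + α * (y1 ^ 2 * (s13 * s14) + y2 ^ 2 * (s23 * s24))) = 0 := by
      linear_combination hT34 + y1 * s13 * h14 - y1 * s14 * h13 + y2 * s23 * h24 - y2 * s24 * h23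
    exact (mul_eq_zero.1 this).resolve_left (sub_ne_zero.2 hy34.symm)
  have hα : α ≠ 0 := by
    intro h0
    have h : s12 = 0 := by
      linear_combination hE1 - (y3 ^ 2 * (s13 * s23) + y4 ^ 2 * (s14 * s24)) * h0
    rw [h, zero_mul] at h12
    exact zero_ne_one h12
  obtain rfl : y4 = -(y1 + y2 + y3) := by linarith
  have hD1 : A13 * A23 * A14 * A24 * (s13 * s23) = A14 * A24 := by
    linear_combination A14 * A24 * (s23 * A23 * h13 + h23)
  have hD2 : A13 * A23 * A14 * A24 * (s14 * s24) = A13 * A23 := by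
    linear_combination A13 * A23 * (s24 * A24 * h14 + h24)
  have hD3 : A13 * A23 * A14 * A24 * (s13 * s14) = A23 * A24 := by
    linear_combination A23 * A24 * (s14 * A14 * h13 + h14)
  have hD4 : A13 * A23 * A14 * A24 * (s23 * s24) = A13 * A14 := by
    linear_combination A13 * A14 * (s24 * A24 * h23 + h24)
  have hD13 : A13 * A23 * A14 * A24 * s13 = A23 * A14 * A24 := by
    linear_combination A23 * A14 * A24 * h13
  have hD23 : A13 * A23 * A14 * A24 * s23 = A13 * A14 * A24 := by
    linear_combination A13 * A14 * A24 * h23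
  have hD14 : A13 * A23 * A14 * A24 * s14 = A13 * A23 * A24 := by
    linear_combination A13 * A23 * A24 * h14
  have hD24 : A13 * A23 * A14 * A24 * s24 = A13 * A23 * A14 := by
    linear_combination A13 * A23 * A14 * h24
  have e1 : A13 * A23 * A14 * A24 * s12 + α * (y3 ^ 2 * (A14 * A24) +
      (-(y1 + y2 + y3)) ^ 2 * (A13 * A23)) = 0 := by
    linear_combination A13 * A23 * A14 * A24 * hE1 - α * y3 ^ 2 * hD1 -
      α * (-(y1 + y2 + y3)) ^ 2 * hD2
  have e2 : A13 * A23 * A14 * A24 * s34 + α * (y1 ^ 2 * (A23 * A24) +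
      y2 ^ 2 * (A13 * A14)) = 0 := by
    linear_combination A13 * A23 * A14 * A24 * hE2 - α * y1 ^ 2 * hD3 - α * y2 ^ 2 * hD4
  have e3 : α * y1 * y2 * (A13 * A23 * A14 * A24 * s12) +
      α * y3 * (-(y1 + y2 + y3)) * (A13 * A23 * A14 * A24 * s34) +
      (α * y1 * y3 * (A23 * A14 * A24) + α * y1 * (-(y1 + y2 + y3)) * (A13 * A23 * A24) +
        α * y2 * y3 * (A13 * A14 * A24) + α * y2 * (-(y1 + y2 + y3)) * (A13 * A23 * A14)) = 0 := by
    linear_combination α * (A13 * A23 * A14 * A24) * hT - α * y1 * y3 * hD13 -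
      α * y1 * (-(y1 + y2 + y3)) * hD14 - α * y2 * y3 * hD23 - α * y2 * (-(y1 + y2 + y3)) * hD24
  refine ⟨_, _, _, A13 * A23 * A14 * A24, rfl, rfl, rfl, ?_, ?_, ?_, ?_, ?_⟩
  · refine mul_ne_zero (mul_ne_zero (mul_ne_zero ?_ ?_) ?_) ?_
    exacts [right_ne_zero_of_mul_eq_one h13, right_ne_zero_of_mul_eq_one h23,
      right_ne_zero_of_mul_eq_one h14, right_ne_zero_of_mul_eq_one h24]
  · rw [hA13, hA14, hA23, hA24]; ring
  · linear_combination e1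
  · linear_combination e2
  · have hw : α * (y1 + y2) ^ 2 ≠ 0 := mul_ne_zero hα (pow_ne_zero _ hσ)
    -- Substituting s12 and s34 from `e1` and `e2` into the cleared relation `e3` leaves only w (1 -
    -- P)(1 - Q).
    refine (mul_eq_zero.1 (?_ : α * (y1 + y2) ^ 2 * _ = 0)).resolve_left hw
    linear_combination -e3 + α * y1 * y2 * e1 + α * y3 * (-(y1 + y2 + y3)) * e2

/-- The first factor of the Dziobek relations gives points of the curve. -/
theorem relations_of_first_factor {y1 y2 y3 y4 α m β s12 s13 s14 s23 s24 s34 w P Q D : ℝ}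
    (h12 : s12 * (1 + α * m * y1 * y2) = 1) (h13 : s13 * (1 + α * y1 * y3) = 1)
    (h14 : s14 * (1 + α * y1 * y4) = 1) (h23 : s23 * (1 + α * y2 * y3) = 1)
    (h24 : s24 * (1 + α * y2 * y4) = 1) (h34 : s34 * (1 + α * β * y3 * y4) = 1)
    (hβ : m * β = 1) (hm : -1 < m) (hsum : y1 + y2 + y3 + y4 = 0)
    (hw : w = α * (y1 + y2) ^ 2) (hP : P = α * y1 * y2) (hQ : Q = α * y3 * y4) (hD0 : D ≠ 0)
    (hD : D = (1 - P * Q) ^ 2 - w * (1 - P) * (1 - Q))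
    (hE1 : D * s12 + (w * (1 - Q) - 2 * Q * (1 - P * Q)) = 0)
    (hE2 : D * s34 + (w * (1 - P) - 2 * P * (1 - P * Q)) = 0) (h1 : P = 1) :
    s13 * s23 = s34 / 2 ∧ s14 * s24 = s34 / 2 ∧ s13 * s14 = s13 + s14 - s34 / 2 ∧
      s23 * s24 = s23 + s24 - s34 / 2 ∧ s13 + s14 + s23 + s24 = 2 * s34 + 1 ∧ s12 = s34 - 1 ∧
      s34 * (m + 1) = m + 2 := by
  have hm1 : m + 1 ≠ 0 := by linarith
  have hm2 : m + 2 ≠ 0 := by linarith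
  have hg2 : D = (1 - Q) ^ 2 := by rw [hD, h1]; ring
  have hg : 1 - Q ≠ 0 := fun h => hD0 (by rw [hg2, h]; ring)
  have hp : α * y1 * y2 = 1 := by rw [← hP, h1]
  have k1 : (1 - Q) * s34 = 2 := mul_left_cancel₀ hg (by
    rw [h1] at hE2; linear_combination hE2 - s34 * hg2)
  have k2 : (1 - Q) * s12 + (w - 2 * Q) = 0 := mul_left_cancel₀ hg (by
    rw [h1] at hE1; linear_combination hE1 - s12 * hg2)
  have h12' : s12 * (1 + m) = 1 := by linear_combination h12 - s12 * m * hp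
  have h34' : s34 * (1 + β * Q) = 1 := by rw [hQ]; linear_combination h34
  have k3 : 1 - Q = 2 * (1 + β * Q) := by
    linear_combination (1 + β * Q) * k1 - (1 - Q) * h34'
  have hQm : Q * (m + 2) = -m := by linear_combination -m * k3 - 2 * Q * hβ
  have k4 : s34 * (m + 1) = m + 2 := by
    linear_combination (m + 2) / 2 * k1 + s34 / 2 * hQm
  have k5 : s12 = s34 - 1 := mul_right_cancel₀ hm1 (by linear_combination h12' - k4)
  have hwg : w = -(1 - Q) := mul_right_cancel₀ hm1 (mul_right_cancel₀ hm2 (by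
    linear_combination (m + 2) * (m + 1) * k2 - (m + 2) * (1 - Q) * h12' + (2 + m) * hQm))
  obtain rfl : y4 = -(y1 + y2 + y3) := by linarith
  set A13 := 1 + α * y1 * y3 with hA13
  set A14 := 1 + α * y1 * -(y1 + y2 + y3) with hA14
  set A23 := 1 + α * y2 * y3 with hA23
  set A24 := 1 + α * y2 * -(y1 + y2 + y3) with hA24
  -- With α y1 y2 = 1, the product is 1 + α y3 (y1 + y2 + y3) = 1 - α y3 y4. Each distance thus
  -- becomes a multiple of the factor belonging to another one.
  have a1 : A13 * A23 = 1 - Q := by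
    rw [hA13, hA23, hQ]; linear_combination α * y3 ^ 2 * hp
  have a2 : A14 * A24 = 1 - Q := by
    rw [hA14, hA24, hQ]; linear_combination α * (y1 + y2 + y3) ^ 2 * hp
  have a3 : A13 * A14 = (1 - Q) * (A13 + A14 - 1) := by
    rw [hA13, hA14, hQ]
    linear_combination α * y3 * (y1 + y2 + y3) * hp
  have a4 : A23 * A24 = (1 - Q) * (A23 + A24 - 1) := by
    rw [hA23, hA24, hQ]
    linear_combination α * y3 * (y1 + y2 + y3) * hp
  have e13 : s13 = s34 / 2 * A23 := by
    linear_combination (-s13 / 2) * k1 + s34 / 2 * A23 * h13 - s34 / 2 * s13 * a1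
  have e23 : s23 = s34 / 2 * A13 := by
    linear_combination (-s23 / 2) * k1 + s34 / 2 * A13 * h23 - s34 / 2 * s23 * a1
  have e14 : s14 = s34 / 2 * A24 := by
    linear_combination (-s14 / 2) * k1 + s34 / 2 * A24 * h14 - s34 / 2 * s14 * a2
  have e24 : s24 = s34 / 2 * A14 := by
    linear_combination (-s24 / 2) * k1 + s34 / 2 * A14 * h24 - s34 / 2 * s24 * a2
  refine ⟨?_, ?_, ?_, ?_, ?_, k5, k4⟩
  · rw [e13, e23]; linear_combination s34 ^ 2 / 4 * a1 + s34 / 4 * k1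
  · rw [e14, e24]; linear_combination s34 ^ 2 / 4 * a2 + s34 / 4 * k1
  · rw [e13, e14]; linear_combination s34 ^ 2 / 4 * a4 + s34 / 4 * (A23 + A24 - 1) * k1
  · rw [e23, e24]; linear_combination s34 ^ 2 / 4 * a3 + s34 / 4 * (A13 + A14 - 1) * k1
  · rw [e13, e23, e14, e24]
    have : A13 + A14 + A23 + A24 = 4 - w := by rw [hA13, hA14, hA23, hA24, hw]; ring
    linear_combination s34 / 2 * this - s34 / 2 * hwg + k1 / 2

/-- The second factor of the Dziobek relations has no real points for `-1 < m ≤ 1`. -/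
theorem false_of_second_factor {y1 y2 y3 y4 α m β s12 s34 w P Q D : ℝ}
    (h12 : s12 * (1 + α * m * y1 * y2) = 1) (h34 : s34 * (1 + α * β * y3 * y4) = 1)
    (hs34 : 0 < s34) (hβ : m * β = 1) (hm : -1 < m) (hm1 : m ≤ 1) (hy12 : y1 ≠ y2)
    (hw : w = α * (y1 + y2) ^ 2) (hP : P = α * y1 * y2) (hQ : Q = α * y3 * y4) (hD0 : D ≠ 0)
    (hD : D = (1 - P * Q) ^ 2 - w * (1 - P) * (1 - Q))
    (hE1 : D * s12 + (w * (1 - Q) - 2 * Q * (1 - P * Q)) = 0)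
    (hE2 : D * s34 + (w * (1 - P) - 2 * P * (1 - P * Q)) = 0) (h1 : Q = 1) : False := by
  have hg2 : D = (1 - P) ^ 2 := by rw [hD, h1]; ring
  have hg : 1 - P ≠ 0 := fun h => hD0 (by rw [hg2, h]; ring)
  have hq : α * y3 * y4 = 1 := by rw [← hQ, h1]
  have k1 : (1 - P) * s12 = 2 := mul_left_cancel₀ hg (by
    rw [h1] at hE1; linear_combination hE1 - s12 * hg2)
  have k2 : (1 - P) * s34 + (w - 2 * P) = 0 := mul_left_cancel₀ hg (by
    rw [h1] at hE2; linear_combination hE2 - s34 * hg2)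
  have h34' : s34 * (m + 1) = m := by
    linear_combination m * h34 - m * s34 * β * hq - s34 * hβ
  have hm0 : 0 < m := by rw [← h34']; exact mul_pos hs34 (by linarith)
  have h12' : s12 * (1 + m * P) = 1 := by rw [hP]; linear_combination h12
  have k3 : 1 - P = 2 * (1 + m * P) := by
    linear_combination (1 + m * P) * k1 - (1 - P) * h12'
  have hPm : P * (1 + 2 * m) = -1 := by linear_combination -k3
  have hwm : w * (1 + 2 * m) = -2 - 2 * m := mul_right_cancel₀ (b := m + 1) (by linarith) (by
    linear_combination (m + 1) * (1 + 2 * m) * k2 - (1 - P) * (1 + 2 * m) * h34' +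
      (3 * m + 2) * hPm)
  have hm12 : 0 < 1 + 2 * m := by linarith
  -- The value of w (1 + 2 m) is -2 - 2 m < 0, and w is α times a square.
  have hα : α < 0 := by
    by_contra h
    have : 0 ≤ w * (1 + 2 * m) := by rw [hw]; have := not_lt.1 h; positivity
    linarith
  have hneg : α * (y1 - y2) ^ 2 * (1 + 2 * m) < 0 :=
    mul_neg_of_neg_of_pos (mul_neg_of_neg_of_pos hα
      (pow_pos (abs_pos.2 (sub_ne_zero.2 hy12)) 2 |>.trans_eq (sq_abs _))) hm12
  -- The square of the difference gives the opposite sign, and here m ≤ 1 is decisive.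
  have : α * (y1 - y2) ^ 2 * (1 + 2 * m) = 2 - 2 * m := by
    have : α * (y1 - y2) ^ 2 = w - 4 * P := by rw [hw, hP]; ring
    rw [this]; linear_combination hwm - 4 * hPm
  linarith

/-! ### Affine dependencies of four points in the plane -/

/-- Twice the signed area of a triangle. -/
def signedArea (p q r : Plane) : ℝ := (q 0 - p 0) * (r 1 - p 1) - (r 0 - p 0) * (q 1 - p 1)

/-- The affine dependency of four points in the plane given by the signed areas of the triangles. -/
def areas (x : Fin 4 → Plane) : Fin 4 → ℝ :=
  ![signedArea (x 1) (x 2) (x 3), -signedArea (x 0) (x 2) (x 3), signedArea (x 0) (x 1) (x 3),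
    -signedArea (x 0) (x 1) (x 2)]

theorem sum_areas (x : Fin 4 → Plane) : areas x 0 + areas x 1 + areas x 2 + areas x 3 = 0 := by
  simp only [areas, signedArea, Matrix.cons_val]; ring

theorem sum_areas_smul (x : Fin 4 → Plane) :
    areas x 0 • x 0 + areas x 1 • x 1 + areas x 2 • x 2 + areas x 3 • x 3 = 0 := by
  apply plane_ext <;>
    simp only [areas, signedArea, Matrix.cons_val, PiLp.add_apply, PiLp.smul_apply, smul_eq_mul,
      PiLp.zero_apply] <;> ring

/-- The weighted sum of the squared distances to the four points does not depend on the point. -/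
theorem sum_areas_mul_dist_sq (x : Fin 4 → Plane) (p q : Plane) :
    areas x 0 * dist p (x 0) ^ 2 + areas x 1 * dist p (x 1) ^ 2 + areas x 2 * dist p (x 2) ^ 2 +
        areas x 3 * dist p (x 3) ^ 2 =
      areas x 0 * dist q (x 0) ^ 2 + areas x 1 * dist q (x 1) ^ 2 + areas x 2 * dist q (x 2) ^ 2 +
        areas x 3 * dist q (x 3) ^ 2 := by
  have hs := sum_areas x
  have h0 := congrArg (fun v : Plane => v 0) (sum_areas_smul x)
  have h1 := congrArg (fun v : Plane => v 1) (sum_areas_smul x)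
  simp only [PiLp.add_apply, PiLp.smul_apply, smul_eq_mul, PiLp.zero_apply] at h0 h1
  simp only [dist_sq_eq_coordinates]
  linear_combination (p 0 ^ 2 + p 1 ^ 2 - q 0 ^ 2 - q 1 ^ 2) * hs - 2 * (p 0 - q 0) * h0 -
    2 * (p 1 - q 1) * h1

/-- Every affine dependency of four points is proportional to the dependency by areas. -/
theorem affineDependency_mul_areas {x : Fin 4 → Plane} {c : Fin 4 → ℝ} (hc : ∑ j, c j = 0)
    (hx : ∑ j, c j • x j = 0) (k l : Fin 4) : c k * areas x l = c l * areas x k := by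
  rw [Fin.sum_univ_four] at hc hx
  have h0 := congrArg (fun v : Plane => v 0) hx
  have h1 := congrArg (fun v : Plane => v 1) hx
  simp only [PiLp.add_apply, PiLp.smul_apply, smul_eq_mul, PiLp.zero_apply] at h0 h1
  -- The signed area is affine in its first vertex, so an affine dependency annihilates it.
  have key : ∀ n p : Fin 4, c 0 * signedArea (x 0) (x n) (x p) + c 1 * signedArea (x 1) (x n) (x p)
      + c 2 * signedArea (x 2) (x n) (x p) + c 3 * signedArea (x 3) (x n) (x p) = 0 := by
    intro n p
    simp only [signedArea]
    linear_combination (x n 0 * x p 1 - x p 0 * x n 1) * hc + (x n 1 - x p 1) * h0 -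
      (x n 0 - x p 0) * h1
  have k01 := key 0 1
  have k02 := key 0 2
  have k03 := key 0 3
  have k12 := key 1 2
  have k13 := key 1 3
  have k23 := key 2 3
  simp only [signedArea] at k01 k02 k03 k12 k13 k23
  have main : c 0 * areas x 1 = c 1 * areas x 0 ∧ c 0 * areas x 2 = c 2 * areas x 0 ∧
      c 0 * areas x 3 = c 3 * areas x 0 ∧ c 1 * areas x 2 = c 2 * areas x 1 ∧
      c 1 * areas x 3 = c 3 * areas x 1 ∧ c 2 * areas x 3 = c 3 * areas x 2 := by
    simp only [areas, signedArea, Matrix.cons_val]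
    refine ⟨?_, ?_, ?_, ?_, ?_, ?_⟩
    · linear_combination -k23
    · linear_combination k13
    · linear_combination -k12
    · linear_combination -k03
    · linear_combination k02
    · linear_combination -k01
  obtain ⟨m01, m02, m03, m12, m13, m23⟩ := main
  fin_cases k <;> fin_cases l <;> first
    | rfl | exact m01 | exact m02 | exact m03 | exact m12 | exact m13 | exact m23
    | exact m01.symm | exact m02.symm | exact m03.symm | exact m12.symm | exact m13.symm
    | exact m23.symm

/-- The coefficient at i is free, because x i - x i = 0; it is chosen to make the total vanish,
which turns the equation into an affine dependency. -/
theorem mul_areas_of_sum_smul_sub {x : Fin 4 → Plane} {c : Fin 4 → ℝ} {i : Fin 4}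
    (h : ∑ j, c j • (x j - x i) = 0) {k l : Fin 4} (hk : k ≠ i) (hl : l ≠ i) :
    c k * areas x l = c l * areas x k := by
  have := affineDependency_mul_areas (x := x) (c := c - Pi.single i (∑ j, c j))
    (by simp) (by
      simp only [Pi.sub_apply, sub_smul, Finset.sum_sub_distrib, Pi.single_apply, ite_smul,
        zero_smul, Finset.sum_ite_eq', Finset.mem_univ, if_true]
      rw [← h, Finset.sum_smul, ← Finset.sum_sub_distrib]
      exact Finset.sum_congr rfl fun j _ => (smul_sub _ _ _).symm) k l
  simpa [Pi.single_apply, hk, hl] using this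

/-- The Dziobek factorization. -/
theorem exists_eq_mul_mul {u : Fin 4 → Fin 4 → ℝ} {y : Fin 4 → ℝ} (hu : ∀ i j, u i j = u j i)
    (h : ∀ i j k, j ≠ i → k ≠ i → u i j * y k = u i k * y j) (hsum : ∑ i, y i = 0)
    (hy : y ≠ 0) : ∃ μ, ∀ i j, i ≠ j → u i j = μ * y i * y j := by
  obtain ⟨i, hi⟩ := Function.ne_iff.1 hy
  rw [Pi.zero_apply] at hi
  -- As the entries sum to zero, a nonzero one has a nonzero partner; this pair fixes μ.
  obtain ⟨j, hji, hj⟩ : ∃ j, j ≠ i ∧ y j ≠ 0 := by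
    by_contra! hcon
    rw [Finset.sum_eq_single i (fun j _ hj => hcon j hj) (by simp)] at hsum
    exact hi hsum
  have h1 : ∀ a, a ≠ i → u i a = u i j / (y i * y j) * y i * y a := fun a ha => by
    field_simp
    linear_combination h i a j ha hji
  refine ⟨u i j / (y i * y j), fun a b hab => ?_⟩
  by_cases ha : a = i
  · subst ha; exact h1 b hab.symm
  by_cases hb : b = i
  · subst hb; rw [hu, h1 a ha]; ring
  refine mul_right_cancel₀ hi ?_
  rw [h a b i hab.symm (Ne.symm ha), hu, h1 a ha]
  ring

theorem exists_eq_smul_of_cross {u v : Plane} (hv : v ≠ 0) (h : v 0 * u 1 - u 0 * v 1 = 0) :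
    ∃ r : ℝ, u = r • v := by
  obtain ⟨τ, hτ⟩ := exists_eq_smul_quarterTurn (u := u) (quarterTurn_ne_zero hv) (by
    rw [quarterTurn_zero, quarterTurn_one]; linear_combination h)
  exact ⟨-τ, by rw [hτ]; apply plane_ext <;> simp⟩

theorem collinear_of_signedArea_eq_zero {x : Fin 4 → Plane} (h01 : x 0 ≠ x 1)
    (h2 : signedArea (x 0) (x 1) (x 2) = 0) (h3 : signedArea (x 0) (x 1) (x 3) = 0) :
    Collinear ℝ (Set.range x) := by
  rw [collinear_iff_of_mem (p₀ := x 0) (Set.mem_range_self 0)]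
  refine ⟨x 1 - x 0, ?_⟩
  rintro _ ⟨i, rfl⟩
  have key : ∀ i, signedArea (x 0) (x 1) (x i) = 0 → ∃ r : ℝ, x i = r • (x 1 - x 0) +ᵥ x 0 := by
    intro i hi
    obtain ⟨r, hr⟩ := exists_eq_smul_of_cross (u := x i - x 0) (sub_ne_zero.2 h01.symm) hi
    exact ⟨r, by rw [vadd_eq_add, ← hr, sub_add_cancel]⟩
  fin_cases i
  · exact ⟨0, by simp⟩
  · exact ⟨1, by simp⟩
  · exact key 2 h2
  · exact key 3 h3

/-! ### Nonzero second strength -/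

theorem mem_zeroLocus_of_ne_zero {m : ℝ} (hm0 : m ≠ 0) {x : Fin 4 → Plane} (hm : -1 < m)
    (hm1 : m ≤ 1) (hinj : Function.Injective x)
    (heq : ∀ i, ∑ j, (strengths m j * (1 / dist (x i) (x j) ^ 2 - 1)) • (x j - x i) = 0)
    (hcol : ¬ Collinear ℝ (Set.range x)) (hsym : ¬ HasLineOfSymmetry x) :
    coordinates x m ∈ zeroLocus ℝ I := by
  have hne : ∀ {i j : Fin 4}, i ≠ j → x i ≠ x j := fun h => hinj.ne h
  set y := areas x with hy
  have hsum := sum_areas x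
  rw [← hy] at hsum
  have hy0 : y ≠ 0 := fun h => hcol (collinear_of_signedArea_eq_zero (hne (by decide))
    (by simpa [hy, areas] using congrFun h 3) (by simpa [hy, areas] using congrFun h 2))
  obtain ⟨μ, hμ⟩ := exists_eq_mul_mul
    (u := fun i j => strengths m i * (strengths m j * (1 / dist (x i) (x j) ^ 2 - 1))) (y := y)
    (fun i j => by rw [dist_comm]; ring)
    (fun i j k hj hk => by
      linear_combination strengths m i * mul_areas_of_sum_smul_sub (heq i) hj hk)
    (by rw [Fin.sum_univ_four]; exact hsum) hy0
  have hs : ∀ {i j : Fin 4}, i ≠ j → 0 < dist (x i) (x j) ^ 2 := fun h => dist_sq_pos (hne h)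
  have hT := sum_areas_mul_dist_sq x
  rw [← hy] at hT
  have hT01 := hT (x 0) (x 1)
  have hT12 := hT (x 1) (x 2)
  have hT23 := hT (x 2) (x 3)
  simp only [dist_self, dist_comm (x 1) (x 0), dist_comm (x 2) (x 0), dist_comm (x 3) (x 0),
    dist_comm (x 2) (x 1), dist_comm (x 3) (x 1), dist_comm (x 3) (x 2)] at hT01 hT12 hT23
  have h01 := hμ 0 1 (by decide)
  have h02 := hμ 0 2 (by decide)
  have h03 := hμ 0 3 (by decide)
  have h12 := hμ 1 2 (by decide)
  have h13 := hμ 1 3 (by decide)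
  have h23 := hμ 2 3 (by decide)
  simp only [strengths, Matrix.cons_val] at h01 h02 h03 h12 h13 h23
  have p01 := hs (i := 0) (j := 1) (by decide)
  have p02 := hs (i := 0) (j := 2) (by decide)
  have p03 := hs (i := 0) (j := 3) (by decide)
  have p12 := hs (i := 1) (j := 2) (by decide)
  have p13 := hs (i := 1) (j := 3) (by decide)
  have p23 := hs (i := 2) (j := 3) (by decide)
  have kite01 := hasLineOfSymmetry_of_kite (x := x) (i := 0) (j := 1) (k := 2) (l := 3) (by decide)
    (hne (by decide))
  have kite23 := hasLineOfSymmetry_of_kite (x := x) (i := 2) (j := 3) (k := 0) (l := 1) (by decide)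
    (hne (by decide))
  rw [dist_comm (x 2) (x 0), dist_comm (x 3) (x 0), dist_comm (x 2) (x 1),
    dist_comm (x 3) (x 1)] at kite23
  have trap := fun t => hasLineOfSymmetry_of_trapezoid (x := x) (t := t) (hne (by decide))
  have hsmul := sum_areas_smul x
  rw [← hy] at hsmul
  simp only [coordinates]
  generalize dist (x 0) (x 1) ^ 2 = s01 at *
  generalize dist (x 0) (x 2) ^ 2 = s02 at *
  generalize dist (x 0) (x 3) ^ 2 = s03 at *
  generalize dist (x 1) (x 2) ^ 2 = s12 at *
  generalize dist (x 1) (x 3) ^ 2 = s13 at *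
  generalize dist (x 2) (x 3) ^ 2 = s23 at *
  have e01 : s01 * (1 + μ / m * m * y 0 * y 1) = 1 := by
    field_simp at h01 ⊢; linear_combination -h01
  have e02 : s02 * (1 + μ / m * y 0 * y 2) = 1 := by
    field_simp at h02 ⊢; linear_combination -h02
  have e03 : s03 * (1 + μ / m * y 0 * y 3) = 1 := by
    field_simp at h03 ⊢; linear_combination -h03
  have e12 : s12 * (1 + μ / m * y 1 * y 2) = 1 := by
    field_simp at h12 ⊢; linear_combination -h12
  have e13 : s13 * (1 + μ / m * y 1 * y 3) = 1 := by
    field_simp at h13 ⊢; linear_combination -h13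
  have e23 : s23 * (1 + μ / m * (1 / m) * y 2 * y 3) = 1 := by
    field_simp at h23 ⊢; linear_combination -h23
  have eq_of : ∀ {s t a : ℝ}, s * a = 1 → t * a = 1 → s = t := fun {s t a} h h' => by
    have ha : a ≠ 0 := right_ne_zero_of_mul_eq_one h
    exact mul_right_cancel₀ ha (h.trans h'.symm)
  -- Equal areas would give equal distances to the other pair, hence a kite.
  have hy01 : y 0 ≠ y 1 := fun h => hsym
    (kite01 (eq_of e02 (by rw [h]; exact e12)) (eq_of e03 (by rw [h]; exact e13)))
  have hy23 : y 2 ≠ y 3 := fun h => hsym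
    (kite23 (eq_of e02 (by rw [h]; exact e03)) (eq_of e12 (by rw [h]; exact e13)))
  -- Otherwise y = (y0, -y0, y2, -y2), so two sides are parallel and the remaining distances agree
  -- in pairs: an isosceles trapezoid.
  have hσ : y 0 + y 1 ≠ 0 := fun h => by
    have e1 : y 1 = -y 0 := by linarith
    have e3 : y 3 = -y 2 := by linarith
    have hy2 : y 2 ≠ 0 := fun h2 => by
      have e3' : y 3 = 0 := by rw [e3, h2, neg_zero]
      exact hy23 (h2.trans e3'.symm)
    refine hsym (trap (-(y 0 / y 2)) ?_ (eq_of e02 ?_) (eq_of e03 ?_))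
    · rw [e1, e3] at hsmul
      have : y 2 • (x 2 - x 3) = y 2 • (-(y 0 / y 2)) • (x 0 - x 1) := by
        rw [smul_smul, mul_neg, mul_div_cancel₀ _ hy2, neg_smul, ← sub_eq_zero, ← hsmul]
        module
      exact smul_right_injective _ hy2 this
    · rw [e1, e3] at e13; linear_combination e13
    · rw [e1] at e12; rw [e3]; linear_combination e12
  obtain ⟨w, P, Q, D, hw, hP, hQ, hD0, hD, hE1, hE2, hfac⟩ := dziobek_relations e01 e02 e03 e12 e13
    e23 hsum (by linear_combination hT01) (by linear_combination hT23)
    -- Weighting the common value of Σⱼ yⱼ sᵢⱼ by yᵢ and summing over i gives zero, since the yᵢ sum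
    -- to zero.
    (by
      linear_combination (y 1 * s01 + y 2 * s02 + y 3 * s03) / 2 * hsum - y 1 / 2 * hT01 -
        y 2 / 2 * (hT01 + hT12) - y 3 / 2 * (hT01 + hT12 + hT23))
    hy01 hy23 hσ
  have hβ : m * (1 / m) = 1 := mul_one_div_cancel hm0
  rcases mul_eq_zero.1 hfac with h | h
  · obtain ⟨r1, r2, r3, r4, r5, r6, r7⟩ := relations_of_first_factor e01 e02 e03 e12 e13 e23 hβ hm
      hsum hw hP hQ hD0 hD hE1 hE2 (by linarith)
    exact mem_zeroLocus_of_relations r1 r2 r3 r4 r5 r6 r7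
  · exact (false_of_second_factor e01 e23 p23 hβ hm hm1 hy01 hw hP hQ hD0 hD hE1 hE2
      (by linarith)).elim

/-! ### Vanishing second strength -/

theorem dist_sq_line {p q r : Plane} (τ : ℝ) : dist r (p + τ • (q - p)) ^ 2 =
    (1 - τ) * dist p r ^ 2 + τ * dist q r ^ 2 - τ * (1 - τ) * dist p q ^ 2 := by
  simp only [dist_sq_eq_coordinates, PiLp.add_apply, PiLp.smul_apply, PiLp.sub_apply, smul_eq_mul]
  ring

/-- The relative equilibria of a vortex without strength in the field of two equal vortices. -/
theorem eq_one_or_exists_of_massless {p q r : Plane} (hpq : dist p q ^ 2 = 1) (hp : r ≠ p)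
    (hq : r ≠ q)
    (h : (1 / dist r p ^ 2 - 1) • (p - r) + (1 / dist r q ^ 2 - 1) • (q - r) = 0) :
    (dist p r ^ 2 = 1 ∧ dist q r ^ 2 = 1) ∨
      ∃ τ : ℝ, r = p + τ • (q - p) ∧ (τ = 1 / 2 ∨ τ ^ 2 = τ + 1) := by
  have hpq' : p ≠ q := fun h => by rw [h, dist_self] at hpq; norm_num at hpq
  have hrp := dist_sq_pos hp
  have hrq := dist_sq_pos hq
  rw [dist_comm p r, dist_comm q r]
  set S := 1 / dist r p ^ 2 - 1 with hS
  set T := 1 / dist r q ^ 2 - 1 with hT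
  by_cases hST : S + T = 0
  · left
    have hS0 : S = 0 := by
      have : S • (p - q) = 0 := by
        rw [← h, eq_neg_of_add_eq_zero_right hST]; module
      exact (smul_eq_zero.1 this).resolve_right (sub_ne_zero.2 hpq')
    have hT0 : T = 0 := by linarith
    rw [hS, sub_eq_zero, div_eq_one_iff_eq hrp.ne'] at hS0
    rw [hT, sub_eq_zero, div_eq_one_iff_eq hrq.ne'] at hT0
    exact ⟨hS0.symm, hT0.symm⟩
  · right
    obtain ⟨τ, hτ⟩ : ∃ τ : ℝ, r = p + τ • (q - p) := by
      refine ⟨T / (S + T), smul_right_injective _ hST ?_⟩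
      change (S + T) • r = (S + T) • _
      rw [smul_add, smul_smul, mul_div_cancel₀ _ hST, ← sub_eq_zero, ← neg_eq_zero, ← h]
      module
    refine ⟨τ, hτ, ?_⟩
    have d1 : dist r p ^ 2 = τ ^ 2 := by
      rw [dist_comm, hτ, dist_sq_line, dist_self, dist_comm q p, hpq]; ring
    have d2 : dist r q ^ 2 = (1 - τ) ^ 2 := by
      rw [dist_comm, hτ, dist_sq_line, dist_self, hpq]; ring
    have hτ0 : τ ≠ 0 := fun h => by rw [d1, h] at hrp; norm_num at hrp
    have hτ1 : 1 - τ ≠ 0 := fun h => by rw [d2, h] at hrq; norm_num at hrq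
    have e : (T * (1 - τ) - S * τ) • (q - p) = 0 := by
      rw [← h, hτ]; module
    have e' := (smul_eq_zero.1 e).resolve_right (sub_ne_zero.2 hpq'.symm)
    rw [hS, hT, d1, d2] at e'
    -- On the line through p and q the balance 1/(1 - τ) - (1 - τ) = 1/τ - τ reduces to this cubic.
    have e2 : (τ - 1 / 2) * (τ ^ 2 - (τ + 1)) = 0 := by
      have hA : 1 / (1 - τ) ^ 2 * (1 - τ) ^ 2 = 1 := one_div_mul_cancel (pow_ne_zero 2 hτ1)
      have hB : 1 / τ ^ 2 * τ ^ 2 = 1 := one_div_mul_cancel (pow_ne_zero 2 hτ0)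
      linear_combination (-τ * (1 - τ) / 2) * e' + τ / 2 * hA - (1 - τ) / 2 * hB
    rcases mul_eq_zero.1 e2 with h | h
    · exact Or.inl (sub_eq_zero.1 h)
    · exact Or.inr (sub_eq_zero.1 h)

/-- The two unit vortices are at distance 1. Each weightless vortex is an apex of an equilateral
triangle, the midpoint, or a golden-ratio point on their line. Two apexes, or an apex and the
midpoint, are symmetric, and two points on the line are collinear, so one apex and one golden-ratio
point remain. -/
theorem mem_zeroLocus_of_eq_zero {x : Fin 4 → Plane} (hinj : Function.Injective x)
    (heq : ∀ i, ∑ j, (strengths 0 j * (1 / dist (x i) (x j) ^ 2 - 1)) • (x j - x i) = 0)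
    (hcol : ¬ Collinear ℝ (Set.range x)) (hsym : ¬ HasLineOfSymmetry x) :
    coordinates x 0 ∈ zeroLocus ℝ I := by
  have hne : ∀ {i j : Fin 4}, i ≠ j → x i ≠ x j := fun h => hinj.ne h
  have hs := dist_sq_pos (hne (i := 0) (j := 1) (by decide))
  have h01 : dist (x 0) (x 1) ^ 2 = 1 := by
    have := heq 0
    simp only [Fin.sum_univ_four, strengths, Matrix.cons_val, zero_mul, zero_smul, sub_self,
      smul_zero, add_zero, zero_add, one_mul] at this
    have := (smul_eq_zero.1 this).resolve_right (sub_ne_zero.2 (hne (by decide)))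
    rw [sub_eq_zero, div_eq_one_iff_eq hs.ne'] at this
    exact this.symm
  have key : ∀ i, i ≠ 0 → i ≠ 1 → (dist (x 0) (x i) ^ 2 = 1 ∧ dist (x 1) (x i) ^ 2 = 1) ∨
      ∃ τ : ℝ, x i = x 0 + τ • (x 1 - x 0) ∧ (τ = 1 / 2 ∨ τ ^ 2 = τ + 1) := by
    intro i h0 h1
    refine eq_one_or_exists_of_massless h01 (hne h0) (hne h1) ?_
    have := heq i
    simpa only [Fin.sum_univ_four, strengths, Matrix.cons_val, zero_mul, zero_smul, sub_self,
      smul_zero, add_zero, zero_add, one_mul] using this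
  have kite := hasLineOfSymmetry_of_kite (x := x) (i := 0) (j := 1) (k := 2) (l := 3) (by decide)
    (hne (by decide))
  have half : ∀ {i : Fin 4}, x i = x 0 + (1 / 2 : ℝ) • (x 1 - x 0) →
      dist (x 0) (x i) ^ 2 = dist (x 1) (x i) ^ 2 := fun {i} h => by
    rw [h, dist_sq_line, dist_sq_line, dist_self, dist_self, dist_comm (x 1) (x 0)]; ring
  have area : ∀ {i : Fin 4} {τ : ℝ}, x i = x 0 + τ • (x 1 - x 0) →
      signedArea (x 0) (x 1) (x i) = 0 := fun {i τ} h => by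
    rw [h]
    simp only [signedArea, PiLp.add_apply, PiLp.smul_apply, PiLp.sub_apply, smul_eq_mul]
    ring
  have golden : ∀ {i j : Fin 4} {τ : ℝ}, x i = x 0 + τ • (x 1 - x 0) → τ ^ 2 = τ + 1 →
      dist (x 0) (x j) ^ 2 = 1 → dist (x 1) (x j) ^ 2 = 1 →
      dist (x 0) (x i) ^ 2 = τ + 1 ∧ dist (x 1) (x i) ^ 2 = 2 - τ ∧
        dist (x j) (x i) ^ 2 = 2 := fun {i j τ} h hτ h0 h1 => by
    rw [h, dist_sq_line, dist_sq_line, dist_sq_line, dist_self, dist_self, dist_comm (x 1) (x 0),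
      h01, h0, h1]
    refine ⟨?_, ?_, ?_⟩ <;> linear_combination hτ
  rcases key 2 (by decide) (by decide) with ⟨a0, a1⟩ | ⟨τ, hτ, hτ'⟩ <;>
    rcases key 3 (by decide) (by decide) with ⟨b0, b1⟩ | ⟨σ, hσ, hσ'⟩
  · exact (hsym (kite (a0.trans a1.symm) (b0.trans b1.symm))).elim
  · rcases hσ' with rfl | hσ'
    · exact (hsym (kite (a0.trans a1.symm) (half hσ))).elim
    · obtain ⟨g0, g1, g2⟩ := golden hσ hσ' a0 a1
      simp only [coordinates, h01, a0, a1, g0, g1, g2]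
      refine mem_zeroLocus_of_relations ?_ ?_ ?_ ?_ ?_ ?_ ?_ <;> simp only [Matrix.cons_val]
      · ring
      · linear_combination -hσ'
      all_goals ring
  · rcases hτ' with rfl | hτ'
    · exact (hsym (kite (half hτ) (b0.trans b1.symm))).elim
    · obtain ⟨g0, g1, g2⟩ := golden hτ hτ' b0 b1
      rw [dist_comm] at g2
      simp only [coordinates, h01, b0, b1, g0, g1, g2]
      refine mem_zeroLocus_of_relations ?_ ?_ ?_ ?_ ?_ ?_ ?_ <;> simp only [Matrix.cons_val]
      · linear_combination -hτ'
      all_goals ring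
  · exact (hcol (collinear_of_signedArea_eq_zero (hne (by decide)) (area hτ) (area hσ))).elim

/-! ### The main theorem -/

theorem mem_zeroLocus_of_mem_asymmetricConfigurations {p : Fin 7 → ℝ}
    (hp : p ∈ asymmetricConfigurations) : p ∈ zeroLocus ℝ I := by
  obtain ⟨m, x, hm, hm1, hre, hcol, hsym, rfl⟩ := hp
  rw [isRelativeEquilibrium_sum_iff hre.1] at hre
  by_cases hm0 : m = 0
  · subst hm0
    exact mem_zeroLocus_of_eq_zero hre.1 hre.2 hcol hsym
  · exact mem_zeroLocus_of_ne_zero hm0 hm hm1 hre.1 hre.2 hcol hsym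

/-- The points of the curve with `s13 = s14` and `s23 = s24` are symmetric configurations. -/
theorem not_mem_asymmetricConfigurations {p : Fin 7 → ℝ} (h12 : p 1 = p 2) (h34 : p 3 = p 4) :
    p ∉ asymmetricConfigurations := by
  rintro ⟨m, x, -, -, hre, -, hsym, rfl⟩
  refine hsym (hasLineOfSymmetry_of_kite (i := 2) (j := 3) (k := 0) (l := 1) (by decide)
    (hre.2.1.ne (by decide)) ?_ ?_)
  · rw [dist_comm, dist_comm (x 3)]; exact h12
  · rw [dist_comm, dist_comm (x 3)]; exact h34

theorem asymmetricConfigurations_eq : asymmetricConfigurations = zeroLocus ℝ I \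
    {![1/2, 1/2, 1/2, 3/2, 3/2, 3/2, 1], ![1/2, 3/2, 3/2, 1/2, 1/2, 3/2, 1]} := by
  ext p
  constructor
  · intro hp
    refine ⟨mem_zeroLocus_of_mem_asymmetricConfigurations hp, ?_⟩
    rintro (rfl | rfl)
    · exact not_mem_asymmetricConfigurations rfl rfl hp
    · exact not_mem_asymmetricConfigurations rfl rfl hp
  · rintro ⟨hp, hne⟩
    rw [zeroLocus_eq_image] at hp
    obtain ⟨z, hz, rfl⟩ := hp
    rw [← curvePoint_one, ← curvePoint_neg_one] at hne
    exact curvePoint_mem_asymmetricConfigurations hz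
      (fun h => hne (Or.inl (congrArg curvePoint h))) fun h => hne (Or.inr (congrArg curvePoint h))

end FourVortex

end

theorem mainTheorem11 :
    FourVortex.asymmetricConfigurations =
        MvPolynomial.zeroLocus ℝ FourVortex.I \
          {![1/2, 1/2, 1/2, 3/2, 3/2, 3/2, 1], ![1/2, 3/2, 3/2, 1/2, 1/2, 3/2, 1]} ∧
      MvPolynomial.zeroLocus ℝ
          (MvPolynomial.vanishingIdeal ℝ FourVortex.asymmetricConfigurations) =
        MvPolynomial.zeroLocus ℝ FourVortex.I ∧
      MvPolynomial.vanishingIdeal ℝ (MvPolynomial.zeroLocus ℝ FourVortex.I) = FourVortex.I ∧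
      FourVortex.realRadical FourVortex.I = FourVortex.I ∧
      FourVortex.HasDimension (MvPolynomial.zeroLocus ℝ FourVortex.I) 1 := by
  refine ⟨FourVortex.asymmetricConfigurations_eq, ?_, FourVortex.vanishingIdeal_zeroLocus_I,
    FourVortex.realRadical_I, FourVortex.hasDimension_zeroLocus_I⟩
  -- Deleting two points leaves infinitely many, so the vanishing ideal is still `I`.
  rw [FourVortex.asymmetricConfigurations_eq,
    FourVortex.vanishingIdeal_zeroLocus_diff ((Set.finite_singleton _).insert _)]
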